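/- Fix a constant $p\in(0,1/2)$ and a constant $\epsilon>0$. For $\mathbf x\in\{0,1\}^n$ let $\mathsf{TH}_k(\mathbf x)=1$ if $\sum_{i=1}^n x_i\ge k$ and $\mathsf{TH}_k(\mathbf x)=0$ otherwise. An algorithm accesses $\mathbf x$ only through noisy queries: at each step it chooses an index $i$, possibly depending on all previous responses (and on internal randomness), and receives $x_i$ with probability $1-p$ and $1-x_i$ with probability $p$, with independent noise for each query. A fixed-length algorithm with $m$ queries makes exactly $m$ queries, where $m$ is a deterministic number, and then outputs a bit $\widehat{\mathsf{TH}}_k$; its worst-case error probability is $\max_{\mathbf x\in\{0,1\}^n}\mathbb P(\widehat{\mathsf{TH}}_k\ne\mathsf{TH}_k(\mathbf x)\mid\mathbf x)$. Let $D_{\mathsf{KL}}(p\|1-p)$ be the Kullback–Leibler divergence between $\mathrm{Bern}(p)$ and $\mathrm{Bern}(1-p)$, and let $\log$ be the natural logarithm. Let $k=k_n\ge 1$ be integers and $\delta=\delta_n$ reals with $k=o(n)$, $\delta=o(1)$ and $\delta\ge n^{-1+\epsilon}$ for all large $n$. Then there is a sequence $\eta_n\to 0$ such that, for all sufficiently large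 $n$: 1. (Necessity) every fixed-length algorithm on $n$ bits whose worst-case error probability for $\mathsf{TH}_k$ is at most $\delta$ makes at least $(1-\eta_n)\,\dfrac{n\log(k/\delta)}{D_{\mathsf{KL}}(p\|1-p)}$ queries; 2. (Sufficiency) there is a fixed-length algorithm on $n$ bits (even one without internal randomness) with at most $(1+\eta_n)\,\dfrac{n\log(k/\delta)}{D_{\mathsf{KL}}(p\|1-p)}$ queries whose worst-case error probability for $\mathsf{TH}_k$ is at most $\delta$. -/

import Mathlib

open Filter Topology Asymptotics MeasureTheory ProbabilityTheory

/-- The threshold function `TH_k` on `n` bits: `true` iff at least `k` of the bits are `true`. -/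
def thresholdFn (k : ℕ) {n : ℕ} (x : Fin n → Bool) : Bool :=
  decide (k ≤ (Finset.univ.filter fun i => x i = true).card)

/-- One noisy reading of the bit `b` through a binary symmetric channel with crossover
probability `p`: the wrong value `!b` with probability `p`, the value `b` with probability
`1 - p`. -/
noncomputable def noisyRead (p : unitInterval) (b : Bool) : PMF Bool :=
  (bernoulliMeasure (!b) b p).toPMF

/-- Deterministic adaptive algorithms on `n` bits that make exactly `m` queries: a query tree all
of whose leaves have depth `m`. At `query i next` the algorithm asks for the bit `i` and, when the
response is `y`, goes on with `next y`; so each query, and the final output, may depend on all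
the previous responses. -/
inductive QueryTree (n : ℕ) : ℕ → Type
  | output (b : Bool) : QueryTree n 0
  | query {m : ℕ} (i : Fin n) (next : Bool → QueryTree n m) : QueryTree n (m + 1)

/-- The law of the output of a query tree on the input `x`; every reading is taken with fresh
independent noise. -/
noncomputable def QueryTree.run {n : ℕ} (p : unitInterval) (x : Fin n → Bool) :
    {m : ℕ} → QueryTree n m → PMF Bool
  | _, .output b => PMF.pure b
  | _, .query i next => (noisyRead p (x i)).bind fun y => (next y).run p x

/-- Fixed-length algorithms with exactly `m` queries, with internal randomness allowed: a random
query tree of depth `m`. -/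
abbrev FixedLengthAlg (n m : ℕ) : Type := PMF (QueryTree n m)

/-- The law of the output of a fixed-length algorithm on the input `x`. -/
noncomputable def FixedLengthAlg.run {n m : ℕ} (p : unitInterval) (x : Fin n → Bool)
    (A : FixedLengthAlg n m) : PMF Bool :=
  PMF.bind A fun T => T.run p x

/-- The probability that `A` does not output `TH_k(x)` on the input `x`. -/
noncomputable def FixedLengthAlg.errorProb {n m : ℕ} (p : unitInterval) (k : ℕ)
    (A : FixedLengthAlg n m) (x : Fin n → Bool) : ℝ :=
  (FixedLengthAlg.run p x A).toMeasure.real {b | b ≠ thresholdFn k x}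

/-- The worst-case error probability: the maximum of the error probability over the (finitely
many) inputs. -/
noncomputable def FixedLengthAlg.worstCaseError {n m : ℕ} (p : unitInterval) (k : ℕ)
    (A : FixedLengthAlg n m) : ℝ :=
  ⨆ x : Fin n → Bool, FixedLengthAlg.errorProb p k A x

/-- The Kullback-Leibler divergence between `Bern(p)` and `Bern(q)`. -/
noncomputable def klBern (p q : unitInterval) : ℝ :=
  (InformationTheory.klDiv (bernoulliMeasure true false p) (bernoulliMeasure true false q)).toReal

/-- The benchmark `n log(k/δ) / D_KL(p ‖ 1-p)`. -/
noncomputable def queryBenchmark (p : unitInterval) (n k : ℕ) (δ : ℝ) : ℝ :=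
  n * Real.log (k / δ) / klBern p (unitInterval.symm p)

/-! Put `L = log((1-p)/p)`. The divergence equals `(1-2p) L`: the drift of the ±1 walk formed by the
readings of one bit, times the log-likelihood ratio of one reading.

Sufficiency. Scan the bits, giving each a sequential likelihood ratio test with asymmetric barriers:
`false` needs evidence `a ≈ log(k/δ)/L`, `true` needs `b ≈ log(2n/δ)/L`, and the scan stops after
`k` declarations of `true`. At or above the threshold, only `k` possible misses matter, each of
probability at most `exp(-L a)`; below it, up to `n` false alarms, each at most `exp(-L b)`. Almost
all bits are `false` and cost about `a/(1-2p)` readings; fewer than `k` bits need the larger effort,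
which is negligible as `k = o(n)`. An exponential moment of the remaining distance makes the length
fixed. See `scanTree_run_false_le` and `scanTree_run_true_le`.

Necessity. Compare inputs `s` with `k-1` ones to inputs `s ∪ {j}`. With `S_j` the balance of bit
`j`, the likelihood ratio is `exp(-L S_j)`. Using it for a single `j` yields only `log(1/δ)`. The
factor `k` comes from averaging over all sets `y` of size `k` and splitting each error event by the
weights `exp(L S_j) / ∑ i ∈ y, exp(L S_i)` (`sum_run_false_eq`): the average over `j ∉ s` of
`1/(exp(L S_j) + Q)` is then of order `δ/k`, where `Q = ∑ i ∈ s, exp(L S_i)` has mean `k-1`. Jensen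
(`log_div_le_average`) forces the average of `L S_j` up to about `log(k/δ)`, while
`expect_exp_sum_le` keeps `∑ S_j` near or below `(1-2p) m`. -/

/-! ### Output laws, error probabilities and the divergence. -/

/-- The probability of the response `y` to a noisy query of the bit `b`. -/
def readProb (p : ℝ) (b y : Bool) : ℝ := if y = b then 1 - p else p

lemma noisyRead_apply (p : unitInterval) (b y : Bool) :
    noisyRead p b y = ENNReal.ofReal (readProb p b y) := by
  rw [noisyRead, Measure.toPMF_apply]
  rw [← ENNReal.ofReal_toReal (measure_ne_top _ {y}), ← measureReal_def]
  congr 1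
  rw [bernoulliMeasure_real_apply _ (measurableSet_singleton y)]
  cases b <;> cases y <;> simp [readProb]

lemma readProb_nonneg {p : ℝ} (h0 : 0 ≤ p) (h1 : p ≤ 1) (b y : Bool) : 0 ≤ readProb p b y := by
  unfold readProb; split_ifs <;> linarith

lemma readProb_add (p : ℝ) (b : Bool) : readProb p b true + readProb p b false = 1 := by
  cases b <;> simp [readProb]

namespace QueryTree

variable {n : ℕ}

/-- The expectation, on the input `x`, of `F S b`, where `b` is the output and `S` is the vector
of the balances (number of responses `false` minus number of responses `true`) of the bits,
started from a given vector. -/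
def expect (p : ℝ) (x : Fin n → Bool) (F : (Fin n → ℤ) → Bool → ℝ) :
    {m : ℕ} → QueryTree n m → (Fin n → ℤ) → ℝ
  | _, .output b, S => F S b
  | _, .query i next, S =>
    readProb p (x i) true * (next true).expect p x F (Function.update S i (S i - 1)) +
    readProb p (x i) false * (next false).expect p x F (Function.update S i (S i + 1))

/-- This payoff ignores the balances, so any starting vector `S` serves; that freedom lets the
balances be reset after a query. -/
lemma run_apply_toReal {m : ℕ} (p : unitInterval) (x : Fin n → Bool) (T : QueryTree n m)
    (b : Bool) (S : Fin n → ℤ) :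
    (T.run p x b).toReal = T.expect p x (fun _ b' => if b' = b then 1 else 0) S := by
  induction T generalizing S with
  | output b' =>
    by_cases h : b' = b
    · simp [run, expect, h]
    · simp [run, expect, h, Ne.symm h]
  | query i next ih =>
    have hr := fun y => readProb_nonneg p.2.1 p.2.2 (x i) y
    rw [run, PMF.bind_apply, tsum_fintype, Fintype.sum_bool, ENNReal.toReal_add
      (ENNReal.mul_ne_top (PMF.apply_ne_top _ _) (PMF.apply_ne_top _ _))
      (ENNReal.mul_ne_top (PMF.apply_ne_top _ _) (PMF.apply_ne_top _ _)),
      ENNReal.toReal_mul, ENNReal.toReal_mul, noisyRead_apply, noisyRead_apply,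
      ENNReal.toReal_ofReal (hr _), ENNReal.toReal_ofReal (hr _), expect, ← ih, ← ih]

end QueryTree

namespace FixedLengthAlg

variable {n m : ℕ}

lemma errorProb_eq (p : unitInterval) (k : ℕ) (A : FixedLengthAlg n m) (x : Fin n → Bool) :
    errorProb p k A x = (∑' T, A T * T.run p x (!thresholdFn k x)).toReal := by
  have h : {b | b ≠ thresholdFn k x} = {!thresholdFn k x} := by
    ext b; cases b <;> cases thresholdFn k x <;> simp
  rw [errorProb, measureReal_def, h, PMF.toMeasure_apply_singleton _ _ (measurableSet_singleton _)]
  rw [FixedLengthAlg.run, PMF.bind_apply]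

lemma errorProb_pure (p : unitInterval) (k : ℕ) (T : QueryTree n m) (x : Fin n → Bool) :
    errorProb p k (PMF.pure T : FixedLengthAlg n m) x = (T.run p x (!thresholdFn k x)).toReal := by
  have h : {b | b ≠ thresholdFn k x} = {!thresholdFn k x} := by
    ext b; cases b <;> cases thresholdFn k x <;> simp
  rw [errorProb, measureReal_def, h, PMF.toMeasure_apply_singleton _ _ (measurableSet_singleton _)]
  rw [FixedLengthAlg.run, PMF.pure_bind]

lemma errorProb_le_worstCaseError (p : unitInterval) (k : ℕ) (A : FixedLengthAlg n m)
    (x : Fin n → Bool) : errorProb p k A x ≤ worstCaseError p k A :=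
  le_ciSup (f := fun x => errorProb p k A x) (Set.finite_range _).bddAbove x

lemma tsum_le_of_worstCaseError_le {p : unitInterval} {k : ℕ} {A : FixedLengthAlg n m} {δ : ℝ}
    (h : worstCaseError p k A ≤ δ) (x : Fin n → Bool) :
    ∑' T, A T * T.run p x (!thresholdFn k x) ≤ ENNReal.ofReal δ := by
  have h1 := (errorProb_le_worstCaseError p k A x).trans h
  rw [errorProb_eq] at h1
  have hne : ∑' T, A T * T.run p x (!thresholdFn k x) ≠ ⊤ := by
    have := (FixedLengthAlg.run p x A).apply_ne_top (!thresholdFn k x)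
    rwa [FixedLengthAlg.run, PMF.bind_apply] at this
  exact (ENNReal.le_ofReal_iff_toReal_le hne (ENNReal.toReal_nonneg.trans h1)).2 h1

end FixedLengthAlg

/-- Under `Bern(p)` the log-likelihood ratio is `-L` with probability `p` and `L` with probability
`1 - p`, where `L = log((1-p)/p)`. -/
lemma klBern_symm (p : unitInterval) (hp0 : (0 : ℝ) < p) (hp1 : (p : ℝ) < 1) :
    klBern p (unitInterval.symm p) = (1 - 2 * p) * Real.log ((1 - p) / p) := by
  set μ := bernoulliMeasure true false p with hμ
  set ν := bernoulliMeasure true false (unitInterval.symm p) with hν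
  have hq : (0 : ℝ) < 1 - p := by linarith
  let f : Bool → ENNReal := fun b =>
    ENNReal.ofReal (if b then (p : ℝ) / (1 - p) else (1 - p) / p)
  have hmeas : ∀ s : Set Bool, MeasurableSet s := fun s => s.to_countable.measurableSet
  have hwd : μ = ν.withDensity f := by
    refine Measure.ext_of_singleton fun b => ?_
    rw [withDensity_apply _ (hmeas _), lintegral_singleton]
    rw [← ENNReal.ofReal_toReal (measure_ne_top μ {b}), ← ENNReal.ofReal_toReal (measure_ne_top ν {b}),
      ← measureReal_def, ← measureReal_def]
    rw [← ENNReal.ofReal_mul (by split_ifs <;> positivity)]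
    congr 1
    rw [hμ, hν, bernoulliMeasure_real_apply _ (measurableSet_singleton b),
      bernoulliMeasure_real_apply _ (measurableSet_singleton b)]
    cases b
    · simp; field_simp
    · simp; field_simp
  have hac : μ ≪ ν := hwd ▸ withDensity_absolutelyContinuous ν f
  have hrn : μ.rnDeriv ν =ᵐ[ν] f := by
    rw [hwd]; exact Measure.rnDeriv_withDensity ν (measurable_of_countable f)
  have hllr : llr μ ν =ᵐ[μ] fun b => Real.log (if b then (p : ℝ) / (1 - p) else (1 - p) / p) := by
    filter_upwards [hac.ae_le hrn] with b hb
    rw [llr, hb, ENNReal.toReal_ofReal (by split_ifs <;> positivity)]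
  rw [klBern, InformationTheory.toReal_klDiv_of_measure_eq hac (by rw [hμ, hν, measure_univ, measure_univ]), integral_congr_ae hllr,
    hμ, integral_bernoulliMeasure]
  have : Real.log ((p : ℝ) / (1 - p)) = - Real.log ((1 - p) / p) := by
    rw [← Real.log_inv, inv_div]
  simp [this]
  ring_nf

/-! ### Sufficiency: the sequential threshold test and its error. -/

/-- The query tree of depth `m` that simulates a deterministic automaton started in the state `s`:
in the state `s` it asks for the bit `q s`, and a response `y` leads to the state `step s y`. -/
def automatonTree {n : ℕ} {σ : Type*} (q : σ → Fin n) (step : σ → Bool → σ) (out : σ → Bool) :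
    (m : ℕ) → σ → QueryTree n m
  | 0, s => .output (out s)
  | m + 1, s => .query (q s) fun y => automatonTree q step out m (step s y)

/-- A potential `Φ` on the good states which is a supermartingale (where leaving the good states
costs `1`) and is at least `1` at the good final states with output `b` bounds the probability
of the output `b`. -/
lemma automatonTree_run_le {n : ℕ} {σ : Type*} (q : σ → Fin n) (step : σ → Bool → σ)
    (out : σ → Bool) (p : unitInterval) (x : Fin n → Bool) (b : Bool) (Good : σ → Prop)
    (Φ : ℕ → σ → ℝ) (h_nonneg : ∀ s, 0 ≤ Φ 0 s) (h_out : ∀ s, Good s → out s = b → 1 ≤ Φ 0 s)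
    (h_step : ∀ m s, Good s → ∃ v : Bool → ℝ,
      readProb p (x (q s)) true * v true + readProb p (x (q s)) false * v false ≤ Φ (m + 1) s ∧
      ∀ y, 1 ≤ v y ∨ (Good (step s y) ∧ Φ m (step s y) ≤ v y))
    (m : ℕ) (s : σ) (hs : Good s) :
    ((automatonTree q step out m s).run p x b).toReal ≤ Φ m s := by
  rw [QueryTree.run_apply_toReal p x _ b 0]
  induction m generalizing s with
  | zero =>
    simp only [automatonTree, QueryTree.expect]
    split_ifs with h
    · exact h_out s hs h
    · exact h_nonneg s
  | succ m ih =>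
    obtain ⟨v, hv, hy⟩ := h_step m s hs
    refine le_trans ?_ hv
    have key : ∀ y S, (automatonTree q step out m (step s y)).expect p x
        (fun _ b' => if b' = b then (1 : ℝ) else 0) S ≤ v y := by
      intro y S
      rcases hy y with h | ⟨h1, h2⟩
      · rw [← QueryTree.run_apply_toReal p x _ b S]
        refine le_trans ?_ h
        exact ENNReal.toReal_le_of_le_ofReal zero_le_one (by simpa using PMF.coe_le_one _ _)
      · rw [← QueryTree.run_apply_toReal p x _ b S, QueryTree.run_apply_toReal p x _ b 0]
        exact (ih _ h1).trans h2
    exact add_le_add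
      (mul_le_mul_of_nonneg_left (key true _) (readProb_nonneg p.2.1 p.2.2 _ _))
      (mul_le_mul_of_nonneg_left (key false _) (readProb_nonneg p.2.1 p.2.2 _ _))

/-- The state of the sequential test: the current bit, the balance of the walk on the current
bit (responses `true` minus responses `false`), and the number of bits declared to be `true`. -/
structure ScanState where
  idx : ℕ
  walk : ℤ
  cnt : ℕ

namespace ScanState

/-- One step of the sequential test with lower barrier `-a` and upper barrier `b`. -/
def step (n k : ℕ) (a b : ℤ) (s : ScanState) (y : Bool) : ScanState :=
  if s.idx < n ∧ s.cnt < k then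
    if y then
      if b ≤ s.walk + 1 then ⟨s.idx + 1, 0, s.cnt + 1⟩ else ⟨s.idx, s.walk + 1, s.cnt⟩
    else
      if s.walk - 1 ≤ -a then ⟨s.idx + 1, 0, s.cnt⟩ else ⟨s.idx, s.walk - 1, s.cnt⟩
  else s

/-- The output is `false` iff all bits have been processed and fewer than `k` of them have been
declared to be `true`. -/
def out (n k : ℕ) (s : ScanState) : Bool := !decide (n ≤ s.idx ∧ s.cnt < k)

/-- The bit to be asked for. -/
def query {n : ℕ} (hn : 0 < n) (s : ScanState) : Fin n :=
  if h : s.idx < n then ⟨s.idx, h⟩ else ⟨0, hn⟩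

end ScanState

/-- The sequential threshold test as a query tree. -/
def scanTree {n : ℕ} (hn : 0 < n) (k : ℕ) (a b : ℤ) (m : ℕ) : QueryTree n m :=
  automatonTree (ScanState.query hn) (ScanState.step n k a b) (ScanState.out n k) m ⟨0, 0, 0⟩

/-- The number of `true` bits among the first `i` bits. -/
def onesBefore {n : ℕ} (x : Fin n → Bool) (i : ℕ) : ℕ :=
  (Finset.univ.filter fun j : Fin n => j.1 < i ∧ x j = true).card

section onesBefore

variable {n : ℕ} (x : Fin n → Bool)

lemma onesBefore_zero : onesBefore x 0 = 0 := by simp [onesBefore]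

lemma onesBefore_all : onesBefore x n = (Finset.univ.filter fun i => x i = true).card := by
  simp [onesBefore]

lemma onesBefore_mono : Monotone (onesBefore x) := fun i j hij =>
  Finset.card_le_card fun l => by simp only [Finset.mem_filter]; grind

lemma onesBefore_succ (i : Fin n) :
    onesBefore x (i + 1) = onesBefore x i + if x i = true then 1 else 0 := by
  unfold onesBefore
  split_ifs with h
  · rw [← Finset.card_insert_of_notMem (a := i) (by simp)]
    congr 1; ext j
    simp only [Finset.mem_filter, Finset.mem_univ, true_and, Finset.mem_insert, Fin.ext_iff]
    constructor
    · rintro ⟨h1, h2⟩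
      rcases Nat.lt_succ_iff_lt_or_eq.1 h1 with h3 | h3
      · exact Or.inr ⟨h3, h2⟩
      · exact Or.inl h3
    · rintro (h1 | ⟨h1, h2⟩)
      · have : j = i := Fin.ext h1
        subst this; exact ⟨by simp, h⟩
      · exact ⟨by omega, h2⟩
  · rw [add_zero]
    congr 1; ext j
    simp only [Finset.mem_filter, Finset.mem_univ, true_and]
    constructor
    · rintro ⟨h1, h2⟩
      refine ⟨lt_of_le_of_ne (Nat.lt_succ_iff.1 h1) fun h3 => h ?_, h2⟩
      rwa [← Fin.ext (a := j) (b := i) h3]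
    · rintro ⟨h1, h2⟩
      exact ⟨by omega, h2⟩

end onesBefore

section scan

variable {n : ℕ} (hn : 0 < n) (k : ℕ) {a b : ℤ} (p : unitInterval) (x : Fin n → Bool)

/-- If at least `k` bits are `true`, the sequential test errs only if one of `k` many `true` bits
is missed. -/
lemma scanTree_run_false_le (ha : 1 ≤ a) (hb : 1 ≤ b) {L : ℝ}
    (hL : p * Real.exp L + (1 - p) * Real.exp (-L) = 1) (hx : k ≤ onesBefore x n) (m : ℕ) :
    ((scanTree hn k a b m).run p x false).toReal ≤ k * Real.exp (-(L * a)) := by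
  classical
  let r : ℝ := Real.exp (-(L * a))
  have hr : 0 < r := Real.exp_pos _
  -- A union bound as a potential. Each of the `k - cnt` declarations still needed is charged `r`,
  -- the bound for a fresh walk on a `true` bit to reach `-a`; on such a bit `exp(-L walk)` is a
  -- martingale by `hL`.
  let Φ : ℕ → ScanState → ℝ := fun _ s =>
    if h : s.idx < n ∧ s.cnt < k then
      if x ⟨s.idx, h.1⟩ = true then (k - s.cnt - 1) * r + Real.exp (-(L * (a + s.walk)))
      else (k - s.cnt) * r
    else 0
  -- The last clause says that the remaining bits hold at least `k - cnt` ones. Only a miss can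
  -- break it, and a miss is charged `1`.
  let Good : ScanState → Prop := fun s =>
    -a < s.walk ∧ s.walk < b ∧ s.idx ≤ n ∧ s.cnt ≤ k ∧ k + onesBefore x s.idx ≤ s.cnt + onesBefore x n
  have cast1 : ∀ s : ScanState, s.cnt < k → (0 : ℝ) ≤ k - s.cnt - 1 := fun s hs => by
    have : ((s.cnt + 1 : ℕ) : ℝ) ≤ k := by exact_mod_cast hs
    push_cast at this; linarith
  have hnn : ∀ m s, 0 ≤ Φ m s := by
    intro m s
    simp only [Φ]
    split_ifs with h h1
    · have := cast1 s h.2; positivity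
    · have : (0 : ℝ) ≤ k - s.cnt := by have := cast1 s h.2; linarith
      positivity
    · exact le_rfl
  have hfresh : ∀ m i c, c ≤ k → Φ m ⟨i, 0, c⟩ ≤ (k - c) * r := by
    intro m i c hc
    have hc' : (c : ℝ) ≤ k := by exact_mod_cast hc
    simp only [Φ]
    split_ifs with h h1
    · simp [r]; linarith
    · exact le_rfl
    · exact mul_nonneg (by linarith) hr.le
  have main := automatonTree_run_le (ScanState.query hn) (ScanState.step n k a b)
    (ScanState.out n k) p x false Good Φ (hnn 0) ?_ ?_ m ⟨0, 0, 0⟩ ?_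
  · refine main.trans ((hfresh m 0 0 (Nat.zero_le _)).trans ?_)
    simp [r]
  -- Running out of queries outputs `true`, so here it is no error and the bound has no term in `m`.
  · rintro s ⟨-, -, h1, h2, h3⟩ ho
    simp only [ScanState.out, Bool.not_eq_false', decide_eq_true_eq] at ho
    obtain ⟨h4, h5⟩ := ho
    have : s.idx = n := le_antisymm h1 h4
    rw [this] at h3; omega
  · rintro m s ⟨hw1, hw2, hi, hc, ho⟩
    by_cases hs : s.idx < n ∧ s.cnt < k
    swap
    · refine ⟨fun _ => 0, ?_, fun y => Or.inr ?_⟩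
      · simpa using hnn (m + 1) s
      · have h1 : ScanState.step n k a b s y = s := by simp only [ScanState.step, if_neg hs]
        rw [h1]
        exact ⟨⟨hw1, hw2, hi, hc, ho⟩, by simp only [Φ, dif_neg hs, le_refl]⟩
    have hq : ScanState.query hn s = ⟨s.idx, hs.1⟩ := by simp [ScanState.query, hs.1]
    have hsucc := onesBefore_succ x ⟨s.idx, hs.1⟩
    simp only at hsucc
    rw [hq]
    have hck := cast1 s hs.2
    by_cases hxi : x ⟨s.idx, hs.1⟩ = true
    · rw [if_pos hxi] at hsucc
      have hv : ∀ w : ℤ, Φ m ⟨s.idx, w, s.cnt⟩ =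
          (k - s.cnt - 1) * r + Real.exp (-(L * (a + w))) := fun w => by
        simp only [Φ, dif_pos hs, if_pos hxi]
      refine ⟨fun y => (k - s.cnt - 1) * r +
        Real.exp (-(L * (a + ((if y then s.walk + 1 else s.walk - 1 : ℤ) : ℝ)))), ?_, ?_⟩
      · have hΦ : Φ (m + 1) s = (k - s.cnt - 1) * r + Real.exp (-(L * (a + s.walk))) := by
          simp only [Φ, dif_pos hs, if_pos hxi]
        rw [hΦ, hxi]
        have e1 : Real.exp (-(L * (a + (s.walk + 1)))) =
            Real.exp (-(L * (a + s.walk))) * Real.exp (-L) := by rw [← Real.exp_add]; ring_nf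
        have e2 : Real.exp (-(L * (a + (s.walk - 1)))) =
            Real.exp (-(L * (a + s.walk))) * Real.exp L := by rw [← Real.exp_add]; ring_nf
        simp only [readProb, if_true, Bool.false_eq_true, if_false, Int.cast_add, Int.cast_sub,
          Int.cast_one, e1, e2]
        refine le_of_eq ?_
        linear_combination Real.exp (-(L * (a + s.walk))) * hL
      · intro y
        cases y
        · simp only [ScanState.step, if_pos hs, Bool.false_eq_true, if_false]
          by_cases hw : s.walk - 1 ≤ -a
          · left
            -- Unit steps cannot overshoot the barrier, so the exponential is exactly `1`.
            have : a + (s.walk - 1) = 0 := by omega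
            have : (a : ℝ) + ((s.walk - 1 : ℤ) : ℝ) = 0 := by exact_mod_cast this
            rw [this]; simp; positivity
          · right
            rw [if_neg hw]
            exact ⟨⟨by simp; omega, by simp; omega, hi, hc, ho⟩, (hv _).le⟩
        · simp only [ScanState.step, if_pos hs, if_true]
          right
          by_cases hw : b ≤ s.walk + 1
          · rw [if_pos hw]
            refine ⟨⟨by simp; omega, by simp; omega, hs.1, hs.2, by simp; omega⟩, ?_⟩
            refine (hfresh m _ _ hs.2).trans ?_
            push_cast
            have := Real.exp_pos (-(L * ((a : ℝ) + (s.walk + 1))))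
            linarith
          · rw [if_neg hw]
            exact ⟨⟨by simp; omega, by simp; omega, hi, hc, ho⟩, (hv _).le⟩
    · rw [if_neg hxi] at hsucc
      have hv : ∀ m, ∀ w : ℤ, Φ m ⟨s.idx, w, s.cnt⟩ = (k - s.cnt) * r := fun m w => by
        simp only [Φ, dif_pos hs, if_neg hxi]
      refine ⟨fun _ => (k - s.cnt) * r, ?_, fun y => Or.inr ?_⟩
      · rw [← add_mul, readProb_add, one_mul]
        exact (hv (m + 1) s.walk).ge
      · cases y
        · simp only [ScanState.step, if_pos hs, Bool.false_eq_true, if_false]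
          split_ifs with hw
          · exact ⟨⟨by simp; omega, by simp; omega, hs.1, hc, by simp; omega⟩, hfresh m _ _ hc⟩
          · exact ⟨⟨by simp; omega, by simp; omega, hi, hc, ho⟩, (hv m _).le⟩
        · simp only [ScanState.step, if_pos hs, if_true]
          split_ifs with hw
          · refine ⟨⟨by simp; omega, by simp; omega, hs.1, hs.2, by simp; omega⟩, ?_⟩
            refine (hfresh m _ _ hs.2).trans ?_
            push_cast
            linarith
          · exact ⟨⟨by simp; omega, by simp; omega, hi, hc, ho⟩, (hv m _).le⟩
  · exact ⟨by simp; omega, by simp; omega, Nat.zero_le _, Nat.zero_le _,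
      by simp [onesBefore_zero]; omega⟩

/-- If fewer than `k` bits are `true`, the sequential test errs only if a `false` bit is declared
to be `true` or the queries do not suffice to process all bits. -/
lemma scanTree_run_true_le (ha : 1 ≤ a) (hb : 1 ≤ b) {L θ t : ℝ} (hL0 : 0 ≤ L) (hθ : 0 ≤ θ)
    (hL : p * Real.exp L + (1 - p) * Real.exp (-L) = 1)
    (ht : p * Real.exp θ + (1 - p) * Real.exp (-θ) ≤ Real.exp (-t))
    (hx : onesBefore x n < k) (m : ℕ) :
    ((scanTree hn k a b m).run p x true).toReal ≤
      n * Real.exp (-(L * b)) + Real.exp (θ * (a * n + b * onesBefore x n) - t * m) := by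
  classical
  let r : ℝ := Real.exp (-(L * b))
  have hr : 0 < r := Real.exp_pos _
  have ha' : (1 : ℝ) ≤ a := by exact_mod_cast ha
  have hb' : (1 : ℝ) ≤ b := by exact_mod_cast hb
  -- An upper bound for the distance the walks must still cover from bit `i` on. A `true` bit is
  -- counted as `a + b`, more than the needed `b`, which keeps the formula simple.
  let H : ℕ → ℝ := fun i => a * (n - i) + b * (onesBefore x n - onesBefore x i)
  have hH : ∀ i, i ≤ n → 0 ≤ H i := fun i hi => by
    have h1 : (i : ℝ) ≤ n := by exact_mod_cast hi
    have h2 : (onesBefore x i : ℝ) ≤ onesBefore x n := by exact_mod_cast onesBefore_mono x hi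
    have h3 : (0 : ℝ) ≤ n - i := by linarith
    have h4 : (0 : ℝ) ≤ (onesBefore x n : ℝ) - onesBefore x i := by linarith
    have : (0 : ℝ) ≤ a := by linarith
    have : (0 : ℝ) ≤ b := by linarith
    simp only [H]; positivity
  -- The `r` terms and `exp(-L (b - walk))` bound the chance of a false alarm; the exponential with
  -- `θ` and `t` is a Chernoff bound for not finishing, since each reading multiplies its mean by at
  -- most `exp(-t)`.
  let Φ : ℕ → ScanState → ℝ := fun m s =>
    if h : s.idx < n then
      if x ⟨s.idx, h⟩ = true then
        (n - s.idx) * r + Real.exp (θ * (H (s.idx + 1) + (b - s.walk)) - t * m)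
      else (n - s.idx - 1) * r + Real.exp (-(L * (b - s.walk))) +
        Real.exp (θ * (H (s.idx + 1) + (a + s.walk)) - t * m)
    else 0
  -- The last clause means that no false alarm has made `cnt` exceed the true count; with `hx` it
  -- prevents the early stop.
  let Good : ScanState → Prop := fun s =>
    -a < s.walk ∧ s.walk < b ∧ s.idx ≤ n ∧ s.cnt ≤ onesBefore x s.idx
  have hlt : ∀ s, Good s → s.cnt < k := fun s hs =>
    (hs.2.2.2.trans (onesBefore_mono x hs.2.2.1)).trans_lt hx
  have cast1 : ∀ i : ℕ, i < n → (0 : ℝ) ≤ n - i - 1 := fun i hi => by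
    have : ((i + 1 : ℕ) : ℝ) ≤ n := by exact_mod_cast hi
    push_cast at this; linarith
  have hnn : ∀ m s, 0 ≤ Φ m s := by
    intro m s
    simp only [Φ]
    split_ifs with h h1
    · have : (0 : ℝ) ≤ n - s.idx := by have := cast1 _ h; linarith
      positivity
    · have := cast1 _ h; positivity
    · exact le_rfl
  have hfresh : ∀ m i c, i ≤ n →
      Φ m ⟨i, 0, c⟩ ≤ (n - i) * r + Real.exp (θ * H i - t * m) := by
    intro m i c hi
    have hi' : (i : ℝ) ≤ n := by exact_mod_cast hi
    simp only [Φ]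
    split_ifs with h h1
    · have hs := onesBefore_succ x ⟨i, h⟩
      simp only [if_pos h1] at hs
      gcongr
      simp only [H, hs]
      push_cast
      linarith
    · have hs := onesBefore_succ x ⟨i, h⟩
      simp only [if_neg h1] at hs
      have : H (i + 1) + (a + ((0 : ℤ) : ℝ)) = H i := by
        simp only [H, hs]; push_cast; ring
      rw [this]
      refine le_of_eq ?_
      simp only [r, Int.cast_zero, sub_zero]; ring
    · have : (0 : ℝ) ≤ n - i := by linarith
      positivity
  have main := automatonTree_run_le (ScanState.query hn) (ScanState.step n k a b)
    (ScanState.out n k) p x true Good Φ (hnn 0) ?_ ?_ m ⟨0, 0, 0⟩ ?_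
  · refine main.trans ((hfresh m 0 0 (Nat.zero_le _)).trans ?_)
    simp [r, H, onesBefore_zero]
  · rintro s hg ho
    have h4 := hlt s hg
    obtain ⟨hw1, hw2, h1, h2⟩ := hg
    simp only [ScanState.out, Bool.not_eq_true', decide_eq_false_iff_not, not_and, not_lt] at ho
    -- Output `true` with `cnt < k` means an unfinished scan; with no query left, the Chernoff term
    -- is at least `1`.
    have h3 : s.idx < n := by
      by_contra h
      have := ho (not_lt.1 h)
      omega
    have c1 : (-a : ℝ) ≤ s.walk := by exact_mod_cast hw1.le
    have c2 : (s.walk : ℝ) ≤ b := by exact_mod_cast hw2.le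
    have c3 := hH (s.idx + 1) h3
    have c4 := cast1 _ h3
    simp only [Φ, dif_pos h3]
    split_ifs with h
    · have e1 : 1 ≤ Real.exp (θ * (H (s.idx + 1) + (b - s.walk)) - t * (0 : ℕ)) := by
        apply Real.one_le_exp
        have : 0 ≤ H (s.idx + 1) + (b - s.walk) := by linarith
        simp; positivity
      have e2 : 0 ≤ ((n : ℝ) - s.idx) * r := mul_nonneg (by linarith) hr.le
      linarith
    · have e1 : 1 ≤ Real.exp (θ * (H (s.idx + 1) + (a + s.walk)) - t * (0 : ℕ)) := by
        apply Real.one_le_exp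
        have : 0 ≤ H (s.idx + 1) + (a + s.walk) := by linarith
        simp; positivity
      have e2 : 0 ≤ ((n : ℝ) - s.idx - 1) * r := mul_nonneg (by linarith) hr.le
      have := Real.exp_pos (-(L * (b - s.walk)))
      linarith
  · rintro m s hg
    have hck := hlt s hg
    obtain ⟨hw1, hw2, hi, hc⟩ := hg
    by_cases hidx : s.idx < n
    swap
    · refine ⟨fun _ => 0, ?_, fun y => Or.inr ?_⟩
      · simpa using hnn (m + 1) s
      · have h1 : ScanState.step n k a b s y = s := by
          simp only [ScanState.step, hidx, false_and, if_false]
        rw [h1]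
        exact ⟨⟨hw1, hw2, hi, hc⟩, by simp only [Φ, dif_neg hidx, le_refl]⟩
    have hs : s.idx < n ∧ s.cnt < k := ⟨hidx, hck⟩
    have hq : ScanState.query hn s = ⟨s.idx, hs.1⟩ := by simp [ScanState.query, hs.1]
    have hsucc := onesBefore_succ x ⟨s.idx, hs.1⟩
    simp only at hsucc
    rw [hq]
    have c4 := cast1 _ hidx
    have et : Real.exp (-t) * Real.exp t = 1 := by rw [← Real.exp_add]; simp
    have c1 : (-a : ℝ) + 1 ≤ s.walk := by exact_mod_cast hw1
    have c2 : (s.walk : ℝ) + 1 ≤ b := by exact_mod_cast hw2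
    by_cases hxi : x ⟨s.idx, hs.1⟩ = true
    · rw [if_pos hxi] at hsucc
      have hv : ∀ m, ∀ w : ℤ, Φ m ⟨s.idx, w, s.cnt⟩ =
          (n - s.idx) * r + Real.exp (θ * (H (s.idx + 1) + (b - w)) - t * m) := fun m w => by
        simp only [Φ, dif_pos hidx, if_pos hxi]
      -- Leaving a `true` bit by either barrier only shortens the remaining distance, so a miss is
      -- harmless here.
      have hE : ∀ w : ℝ, w ≤ b → (((n : ℝ) - (s.idx + 1 : ℕ)) * r +
          Real.exp (θ * H (s.idx + 1) - t * m)) ≤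
          (n - s.idx) * r + Real.exp (θ * (H (s.idx + 1) + (b - w)) - t * m) := by
        intro w hw
        gcongr
        · linarith
        · linarith
      refine ⟨fun y => (n - s.idx) * r + Real.exp (θ * (H (s.idx + 1) +
        (b - ((if y then s.walk + 1 else s.walk - 1 : ℤ) : ℝ))) - t * m), ?_, ?_⟩
      · refine le_trans ?_ (hv (m + 1) s.walk).ge
        rw [hxi]
        set E := Real.exp (θ * (H (s.idx + 1) + (b - s.walk)) - t * (m + 1 : ℕ)) with hEdef
        have e1 : Real.exp (θ * (H (s.idx + 1) + (b - (s.walk + 1))) - t * m) =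
            E * Real.exp t * Real.exp (-θ) := by
          rw [hEdef, ← Real.exp_add, ← Real.exp_add]; push_cast; ring_nf
        have e2 : Real.exp (θ * (H (s.idx + 1) + (b - (s.walk - 1))) - t * m) =
            E * Real.exp t * Real.exp θ := by
          rw [hEdef, ← Real.exp_add, ← Real.exp_add]; push_cast; ring_nf
        simp only [readProb, if_true, Bool.false_eq_true, if_false, Int.cast_add, Int.cast_sub,
          Int.cast_one, e1, e2]
        have hpos : 0 ≤ E * Real.exp t := by positivity
        have := mul_le_mul_of_nonneg_left ht hpos
        have e3 : E * Real.exp t * Real.exp (-t) = E := by rw [mul_assoc, mul_comm (Real.exp t), et, mul_one]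
        linarith
      · intro y
        right
        cases y
        · simp only [ScanState.step, if_pos hs, Bool.false_eq_true, if_false]
          split_ifs with hw
          · refine ⟨⟨by simp; omega, by simp; omega, hs.1, by simp; omega⟩,
              (hfresh m _ _ hs.1).trans (hE _ ?_)⟩
            push_cast; linarith
          · exact ⟨⟨by simp; omega, by simp; omega, hi, hc⟩, (hv m _).le⟩
        · simp only [ScanState.step, if_pos hs, if_true]
          split_ifs with hw
          · refine ⟨⟨by simp; omega, by simp; omega, hs.1, by simp; omega⟩,
              (hfresh m _ _ hs.1).trans (hE _ ?_)⟩
            push_cast; linarith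
          · exact ⟨⟨by simp; omega, by simp; omega, hi, hc⟩, (hv m _).le⟩
    · rw [if_neg hxi] at hsucc
      have hv : ∀ m, ∀ w : ℤ, Φ m ⟨s.idx, w, s.cnt⟩ = (n - s.idx - 1) * r +
          Real.exp (-(L * (b - w))) + Real.exp (θ * (H (s.idx + 1) + (a + w)) - t * m) :=
        fun m w => by simp only [Φ, dif_pos hidx, if_neg hxi]
      refine ⟨fun y => (n - s.idx - 1) * r +
        Real.exp (-(L * (b - ((if y then s.walk + 1 else s.walk - 1 : ℤ) : ℝ)))) +
        Real.exp (θ * (H (s.idx + 1) +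
        (a + ((if y then s.walk + 1 else s.walk - 1 : ℤ) : ℝ))) - t * m), ?_, ?_⟩
      · refine le_trans ?_ (hv (m + 1) s.walk).ge
        rw [Bool.not_eq_true] at hxi
        rw [hxi]
        set E := Real.exp (θ * (H (s.idx + 1) + (a + s.walk)) - t * (m + 1 : ℕ)) with hEdef
        have e1 : Real.exp (θ * (H (s.idx + 1) + (a + (s.walk + 1))) - t * m) =
            E * Real.exp t * Real.exp θ := by
          rw [hEdef, ← Real.exp_add, ← Real.exp_add]; push_cast; ring_nf
        have e2 : Real.exp (θ * (H (s.idx + 1) + (a + (s.walk - 1))) - t * m) =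
            E * Real.exp t * Real.exp (-θ) := by
          rw [hEdef, ← Real.exp_add, ← Real.exp_add]; push_cast; ring_nf
        have e4 : Real.exp (-(L * (b - (s.walk + 1)))) =
            Real.exp (-(L * (b - s.walk))) * Real.exp L := by rw [← Real.exp_add]; ring_nf
        have e5 : Real.exp (-(L * (b - (s.walk - 1)))) =
            Real.exp (-(L * (b - s.walk))) * Real.exp (-L) := by rw [← Real.exp_add]; ring_nf
        simp only [readProb, if_true, Bool.true_eq_false, if_false, Int.cast_add, Int.cast_sub,
          Int.cast_one, Bool.false_eq_true, e1, e2, e4, e5]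
        have hpos : 0 ≤ E * Real.exp t := by positivity
        have := mul_le_mul_of_nonneg_left ht hpos
        have e3 : E * Real.exp t * Real.exp (-t) = E := by rw [mul_assoc, mul_comm (Real.exp t), et, mul_one]
        have e6 := congrArg (Real.exp (-(L * (b - s.walk))) * ·) hL
        linarith
      · intro y
        cases y
        · right
          simp only [ScanState.step, if_pos hs, Bool.false_eq_true, if_false]
          split_ifs with hw
          · refine ⟨⟨by simp; omega, by simp; omega, hs.1, by simp; omega⟩,
              (hfresh m _ _ hs.1).trans ?_⟩
            have h1 : (n : ℝ) - (s.idx + 1 : ℕ) = n - s.idx - 1 := by push_cast; ring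
            rw [h1]
            have h2 := Real.exp_pos (-(L * (b - ((s.walk - 1 : ℤ) : ℝ))))
            have h3 : Real.exp (θ * H (s.idx + 1) - t * m) ≤
                Real.exp (θ * (H (s.idx + 1) + (a + ((s.walk - 1 : ℤ) : ℝ))) - t * m) := by
              gcongr; push_cast; linarith
            linarith
          · exact ⟨⟨by simp; omega, by simp; omega, hi, hc⟩, (hv m _).le⟩
        · simp only [ScanState.step, if_pos hs, if_true]
          by_cases hw : b ≤ s.walk + 1
          · left
            have h1 : (b : ℝ) - ((s.walk + 1 : ℤ) : ℝ) ≤ 0 := by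
              have : (b : ℝ) ≤ ((s.walk + 1 : ℤ) : ℝ) := by exact_mod_cast hw
              linarith
            have h2 : 1 ≤ Real.exp (-(L * (b - ((s.walk + 1 : ℤ) : ℝ)))) := by
              apply Real.one_le_exp
              have := mul_nonneg hL0 (neg_nonneg.2 h1)
              linarith
            have h3 : 0 ≤ ((n : ℝ) - s.idx - 1) * r := by positivity
            have h4 := Real.exp_pos (θ * (H (s.idx + 1) + (a + ((s.walk + 1 : ℤ) : ℝ))) - t * m)
            linarith
          · right
            rw [if_neg hw]
            exact ⟨⟨by simp; omega, by simp; omega, hi, hc⟩, (hv m _).le⟩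
  · exact ⟨by simp; omega, by simp; omega, Nat.zero_le _, Nat.zero_le _⟩

/-- The worst-case error of the sequential threshold test. -/
lemma scanTree_worstCaseError_le (ha : 1 ≤ a) (hb : 1 ≤ b) {L θ t : ℝ} (hL0 : 0 ≤ L) (hθ : 0 ≤ θ)
    (hL : p * Real.exp L + (1 - p) * Real.exp (-L) = 1)
    (ht : p * Real.exp θ + (1 - p) * Real.exp (-θ) ≤ Real.exp (-t)) (m : ℕ) {δ : ℝ}
    (h1 : k * Real.exp (-(L * a)) ≤ δ)
    (h2 : n * Real.exp (-(L * b)) + Real.exp (θ * (a * n + b * k) - t * m) ≤ δ) :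
    FixedLengthAlg.worstCaseError p k (PMF.pure (scanTree hn k a b m) : FixedLengthAlg n m) ≤ δ := by
  refine ciSup_le fun x => ?_
  rw [FixedLengthAlg.errorProb_pure]
  by_cases hx : k ≤ onesBefore x n
  · have : thresholdFn k x = true := by simpa [thresholdFn, ← onesBefore_all] using hx
    rw [this]
    exact (scanTree_run_false_le hn k p x ha hb hL hx m).trans h1
  · have : thresholdFn k x = false := by
      simpa [thresholdFn, ← onesBefore_all] using hx
    rw [this]
    refine (scanTree_run_true_le hn k p x ha hb hL0 hθ hL ht (not_le.1 hx) m).trans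
      (le_trans ?_ h2)
    have hb' : (0 : ℝ) ≤ b := by exact_mod_cast (by omega : 0 ≤ b)
    gcongr
    exact (not_le.1 hx).le

end scan

/-! ### Necessity: change of measure and exponential moments. -/

namespace QueryTree

variable {n m : ℕ} {p : ℝ} {x : Fin n → Bool}

lemma expect_mono (h0 : 0 ≤ p) (h1 : p ≤ 1) {F G : (Fin n → ℤ) → Bool → ℝ}
    (h : ∀ S b, F S b ≤ G S b) (T : QueryTree n m) (S : Fin n → ℤ) :
    T.expect p x F S ≤ T.expect p x G S := by
  induction T generalizing S with
  | output b => exact h S b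
  | query i next ih =>
    exact add_le_add (mul_le_mul_of_nonneg_left (ih _ _) (readProb_nonneg h0 h1 _ _))
      (mul_le_mul_of_nonneg_left (ih _ _) (readProb_nonneg h0 h1 _ _))

lemma expect_add (F G : (Fin n → ℤ) → Bool → ℝ) (T : QueryTree n m) (S : Fin n → ℤ) :
    T.expect p x (fun S b => F S b + G S b) S = T.expect p x F S + T.expect p x G S := by
  induction T generalizing S with
  | output b => rfl
  | query i next ih => simp only [expect, ih]; ring

lemma expect_mul_const (F : (Fin n → ℤ) → Bool → ℝ) (c : ℝ) (T : QueryTree n m)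
    (S : Fin n → ℤ) :
    T.expect p x (fun S b => F S b * c) S = T.expect p x F S * c := by
  induction T generalizing S with
  | output b => rfl
  | query i next ih => simp only [expect, ih]; ring

lemma expect_const (c : ℝ) (T : QueryTree n m) (S : Fin n → ℤ) :
    T.expect p x (fun _ _ => c) S = c := by
  induction T generalizing S with
  | output b => rfl
  | query i next ih => simp only [expect, ih]; rw [← add_mul, readProb_add, one_mul]

lemma expect_sum {ι : Type*} (J : Finset ι) (F : ι → (Fin n → ℤ) → Bool → ℝ)
    (T : QueryTree n m) (S : Fin n → ℤ) :
    T.expect p x (fun S b => ∑ j ∈ J, F j S b) S = ∑ j ∈ J, T.expect p x (F j) S := by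
  classical
  induction J using Finset.induction_on with
  | empty => simpa using expect_const 0 T S
  | insert j J hj ih => simp only [Finset.sum_insert hj, expect_add, ih]

/-- Change of measure: turning the bit `j` from `false` to `true` multiplies the likelihood by
`exp (-L S_j)`. -/
lemma expect_update (j : Fin n) (hx : x j = false) {L : ℝ} (hL : p * Real.exp L = 1 - p)
    (F : (Fin n → ℤ) → Bool → ℝ) (T : QueryTree n m) (S : Fin n → ℤ) :
    T.expect p (Function.update x j true) F S =
      T.expect p x (fun S' b => F S' b * Real.exp (-(L * (S' j - S j)))) S := by
  induction T generalizing S with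
  | output b => simp [expect]
  | query i next ih =>
    simp only [expect, ih]
    have hL' : (1 - p) * Real.exp (-L) = p := by
      rw [← hL, mul_assoc, ← Real.exp_add]; simp
    by_cases hij : i = j
    · subst hij
      simp only [Function.update_self, hx, readProb, Bool.false_eq_true, Bool.true_eq_false,
        if_true, if_false]
      have e1 : ∀ S' : Fin n → ℤ, Real.exp (-(L * (S' i - S i))) =
          Real.exp (-(L * (S' i - (S i - 1 : ℤ)))) * Real.exp L := fun S' => by
        rw [← Real.exp_add]; push_cast; ring_nf
      have e2 : ∀ S' : Fin n → ℤ, Real.exp (-(L * (S' i - S i))) =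
          Real.exp (-(L * (S' i - (S i + 1 : ℤ)))) * Real.exp (-L) := fun S' => by
        rw [← Real.exp_add]; push_cast; ring_nf
      have h1 : ∀ S₀, (next true).expect p x (fun S' b => F S' b *
          Real.exp (-(L * (S' i - S i)))) S₀ = (next true).expect p x (fun S' b => F S' b *
          Real.exp (-(L * (S' i - (S i - 1 : ℤ))))) S₀ * Real.exp L := fun S₀ => by
        rw [← expect_mul_const]; simp only [e1, mul_assoc]
      have h2 : ∀ S₀, (next false).expect p x (fun S' b => F S' b *
          Real.exp (-(L * (S' i - S i)))) S₀ = (next false).expect p x (fun S' b => F S' b *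
          Real.exp (-(L * (S' i - (S i + 1 : ℤ))))) S₀ * Real.exp (-L) := fun S₀ => by
        rw [← expect_mul_const]; simp only [e2, mul_assoc]
      rw [h1, h2]
      set A := (next true).expect p x (fun S' b => F S' b *
          Real.exp (-(L * (S' i - (S i - 1 : ℤ))))) (Function.update S i (S i - 1))
      set B := (next false).expect p x (fun S' b => F S' b *
          Real.exp (-(L * (S' i - (S i + 1 : ℤ))))) (Function.update S i (S i + 1))
      linear_combination (-A) * hL - B * hL'
    · rw [Function.update_of_ne hij]
      simp only [Function.update_of_ne (Ne.symm hij)]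

/-- A likelihood ratio has mean one. -/
lemma expect_exp_neg (j : Fin n) (hx : x j = false) {L : ℝ} (hL : p * Real.exp L = 1 - p)
    (T : QueryTree n m) : T.expect p x (fun S _ => Real.exp (-(L * S j))) 0 = 1 := by
  have := expect_update j hx hL (fun _ _ => 1) T 0
  rw [expect_const] at this
  simpa using this.symm

/-- The inverse ratio also has mean one: lowering bit `j` brings in a factor that cancels the
payoff. -/
lemma expect_exp (j : Fin n) (hx : x j = true) {L : ℝ} (hL : p * Real.exp L = 1 - p)
    (T : QueryTree n m) : T.expect p x (fun S _ => Real.exp (L * S j)) 0 = 1 := by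
  have h := expect_update (x := Function.update x j false) j (by simp) hL
    (fun S _ => Real.exp (L * S j)) T 0
  rw [Function.update_idem, ← hx, Function.update_eq_self] at h
  rw [h]
  simp only [← Real.exp_add]
  simpa using expect_const 1 T 0

/-- The exponential moments of the total balance over a set of `false` bits. -/
lemma expect_exp_sum_le (h0 : 0 ≤ p) (h1 : p ≤ 1) (J : Finset (Fin n))
    (hJ : ∀ j ∈ J, x j = false) {l c : ℝ} (hc : 0 ≤ c)
    (hlc : p * Real.exp (-l) + (1 - p) * Real.exp l ≤ Real.exp c) (T : QueryTree n m)
    (S : Fin n → ℤ) :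
    T.expect p x (fun S _ => Real.exp (l * ∑ j ∈ J, (S j : ℝ))) S ≤
      Real.exp (c * m) * Real.exp (l * ∑ j ∈ J, (S j : ℝ)) := by
  induction T generalizing S with
  | output b => simp [expect]
  | @query m i next ih =>
    have hr := readProb_nonneg h0 h1 (x i)
    refine (add_le_add (mul_le_mul_of_nonneg_left (ih _ _) (hr _))
      (mul_le_mul_of_nonneg_left (ih _ _) (hr _))).trans ?_
    have hcm : Real.exp (c * (m + 1 : ℕ)) = Real.exp (c * m) * Real.exp c := by
      rw [← Real.exp_add]; push_cast; ring_nf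
    rw [hcm]
    set E := Real.exp (l * ∑ j ∈ J, (S j : ℝ)) with hE
    have hsum : ∀ z : ℤ, ∑ j ∈ J, ((Function.update S i (S i + z) j : ℤ) : ℝ) =
        ∑ j ∈ J, (S j : ℝ) + if i ∈ J then (z : ℝ) else 0 := fun z => by
      rw [← Finset.sum_ite_eq' J i (fun _ => (z : ℝ)), ← Finset.sum_add_distrib]
      refine Finset.sum_congr rfl fun j _ => ?_
      by_cases hji : j = i
      · subst hji; simp
      · simp [hji]
    have hs1 := hsum (-1)
    have hs2 := hsum 1
    rw [← sub_eq_add_neg] at hs1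
    rw [hs1, hs2]
    by_cases hi : i ∈ J
    · simp only [if_pos hi, hJ i hi, readProb, Bool.true_eq_false, if_true, if_false,
        Int.cast_neg, Int.cast_one, mul_add, Real.exp_add, ← hE]
      have hpos : 0 ≤ Real.exp (c * m) * E := by positivity
      have := mul_le_mul_of_nonneg_left hlc hpos
      have e : l * (-1) = -l := by ring
      rw [e, mul_one]
      linarith
    · simp only [if_neg hi, add_zero, ← hE]
      rw [← add_mul, readProb_add, one_mul]
      have : 1 ≤ Real.exp c := Real.one_le_exp hc
      have hpos : 0 ≤ Real.exp (c * m) * E := by positivity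
      nlinarith

end QueryTree

/-! ### Necessity: averaging over the inputs next to the threshold. -/

/-- Double counting: pairs `j ∈ y` correspond to pairs `j ∉ s` via `s = y.erase j`. -/
lemma Finset.sum_powersetCard_succ_sum_erase {α M : Type*} [Fintype α] [DecidableEq α]
    [AddCommMonoid M] (l : ℕ) (f : Finset α → α → M) :
    ∑ y ∈ Finset.powersetCard (l + 1) (Finset.univ : Finset α), ∑ j ∈ y, f (y.erase j) j =
      ∑ s ∈ Finset.powersetCard l (Finset.univ : Finset α), ∑ j ∈ sᶜ, f s j := by
  rw [Finset.sum_sigma', Finset.sum_sigma']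
  refine Finset.sum_bij' (fun a _ => ⟨a.1.erase a.2, a.2⟩) (fun a _ => ⟨insert a.2 a.1, a.2⟩)
    ?_ ?_ ?_ ?_ ?_
  · rintro ⟨y, j⟩ h
    simp only [Finset.mem_sigma, Finset.mem_powersetCard_univ, Finset.mem_compl] at h ⊢
    exact ⟨by rw [Finset.card_erase_of_mem h.2, h.1]; rfl, Finset.notMem_erase _ _⟩
  · rintro ⟨s, j⟩ h
    simp only [Finset.mem_sigma, Finset.mem_powersetCard_univ, Finset.mem_compl] at h ⊢
    exact ⟨by rw [Finset.card_insert_of_notMem h.2, h.1], Finset.mem_insert_self _ _⟩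
  · rintro ⟨y, j⟩ h
    simp only [Finset.mem_sigma] at h
    simp [Finset.insert_erase h.2]
  · rintro ⟨s, j⟩ h
    simp only [Finset.mem_sigma, Finset.mem_compl] at h
    simp [Finset.erase_insert h.2]
  · rintro ⟨y, j⟩ h; rfl

lemma PMF.exists_lt_of_tsum_mul_lt {α : Type*} (A : PMF α) (G : α → ENNReal) {d : ENNReal}
    (h : ∑' a, A a * G a < d) : ∃ a, G a < d := by
  by_contra! hG
  refine h.not_ge ?_
  calc d = ∑' a, A a * d := by rw [ENNReal.tsum_mul_right, A.tsum_coe, one_mul]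
    _ ≤ _ := ENNReal.tsum_le_tsum fun a => mul_le_mul_right (hG a) _

/-- The bit vector whose `true` bits are the elements of `s`. -/
def bitsOf {n : ℕ} (s : Finset (Fin n)) : Fin n → Bool := fun i => decide (i ∈ s)

lemma thresholdFn_bitsOf {n k : ℕ} (s : Finset (Fin n)) :
    thresholdFn k (bitsOf s) = decide (k ≤ s.card) := by
  simp [thresholdFn, bitsOf]

lemma bitsOf_insert {n : ℕ} (s : Finset (Fin n)) (j : Fin n) :
    bitsOf (insert j s) = Function.update (bitsOf s) j true := by
  ext i
  by_cases h : i = j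
  · subst h; simp [bitsOf]
  · simp [bitsOf, h]

/-- The total likelihood of the inputs `s ∪ {j}`, `j ∉ s`, of missing the `true` bits, relative
to the posterior weights. -/
noncomputable def missWeight {n : ℕ} (L : ℝ) (s : Finset (Fin n)) (S : Fin n → ℤ) : ℝ :=
  ∑ j ∈ sᶜ, (Real.exp (L * S j) + ∑ i ∈ s, Real.exp (L * S i))⁻¹

/-- Weights summing to `1` over `j ∈ y` split each error, and the `j`-th part is moved to the input
`y.erase j`. The ratio `exp(-L S_j)` cancels the numerator of the weight, leaving the bounded-below
denominator that yields the factor `k`. -/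
lemma sum_run_false_eq {n m l : ℕ} (p : unitInterval) {L : ℝ} (hL : p * Real.exp L = 1 - p)
    (T : QueryTree n m) :
    ∑ y ∈ Finset.powersetCard (l + 1) (Finset.univ : Finset (Fin n)),
        (T.run p (bitsOf y) false).toReal =
      ∑ s ∈ Finset.powersetCard l (Finset.univ : Finset (Fin n)),
        T.expect p (bitsOf s) (fun S b => if b = false then missWeight L s S else 0) 0 := by
  have h1 : ∀ y ∈ Finset.powersetCard (l + 1) (Finset.univ : Finset (Fin n)),
      (T.run p (bitsOf y) false).toReal = ∑ j ∈ y, T.expect p (bitsOf (y.erase j))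
        (fun S b => if b = false then (Real.exp (L * S j) +
          ∑ i ∈ y.erase j, Real.exp (L * S i))⁻¹ else 0) 0 := by
    intro y hy
    have hne : y.Nonempty := by
      rw [← Finset.card_pos, (Finset.mem_powersetCard_univ.1 hy)]; omega
    rw [QueryTree.run_apply_toReal p _ T false 0]
    have h2 : (fun (_ : Fin n → ℤ) (b' : Bool) => if b' = false then (1 : ℝ) else 0) =
        fun S b' => ∑ j ∈ y, if b' = false then
          Real.exp (L * S j) * (∑ i ∈ y, Real.exp (L * S i))⁻¹ else 0 := by
      ext S b'
      split_ifs
      · rw [← Finset.sum_mul, mul_inv_cancel₀]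
        exact (Finset.sum_pos (fun i _ => Real.exp_pos _) hne).ne'
      · simp
    rw [h2, QueryTree.expect_sum]
    refine Finset.sum_congr rfl fun j hj => ?_
    have h3 : bitsOf y = Function.update (bitsOf (y.erase j)) j true := by
      rw [← bitsOf_insert, Finset.insert_erase hj]
    rw [h3, QueryTree.expect_update j (by simp [bitsOf]) hL]
    congr 1
    ext S b'
    split_ifs
    · rw [Finset.add_sum_erase y (fun i => Real.exp (L * S i)) hj, mul_right_comm, ← Real.exp_add]
      simp
    · simp
  rw [Finset.sum_congr rfl h1, Finset.sum_powersetCard_succ_sum_erase l (fun s j =>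
    T.expect p (bitsOf s) (fun S b => if b = false then (Real.exp (L * S j) +
          ∑ i ∈ s, Real.exp (L * S i))⁻¹ else 0) 0)]
  refine Finset.sum_congr rfl fun s _ => ?_
  rw [← QueryTree.expect_sum]
  congr 1
  ext S b
  split_ifs <;> simp [missWeight]

/-- A randomized algorithm with small worst-case error yields a deterministic one, and an input
just below the threshold, with small average error. -/
lemma exists_tree_input {n m l : ℕ} (hl : l < n) (p : unitInterval) {L δ : ℝ}
    (hL : p * Real.exp L = 1 - p) (hδ : 0 < δ) (A : FixedLengthAlg n m)
    (hA : FixedLengthAlg.worstCaseError p (l + 1) A ≤ δ) :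
    ∃ (T : QueryTree n m) (s : Finset (Fin n)), s.card = l ∧
      (T.run p (bitsOf s) true).toReal + (l + 1 : ℕ) / (n - l : ℕ) *
        T.expect p (bitsOf s) (fun S b => if b = false then missWeight L s S else 0) 0 ≤ 3 * δ := by
  set P := Finset.powersetCard l (Finset.univ : Finset (Fin n)) with hP
  set Y := Finset.powersetCard (l + 1) (Finset.univ : Finset (Fin n)) with hY
  have hPc : P.card = n.choose l := by simp [hP]
  have hYc : Y.card = n.choose (l + 1) := by simp [hY]
  have hPpos : 0 < P.card := hPc ▸ Nat.choose_pos hl.le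
  have hYpos : 0 < Y.card := hYc ▸ Nat.choose_pos hl
  -- The cross weights give the two average errors equal influence.
  let G : QueryTree n m → ENNReal := fun T =>
    Y.card * ∑ s ∈ P, T.run p (bitsOf s) true + P.card * ∑ y ∈ Y, T.run p (bitsOf y) false
  have herr : ∀ s : Finset (Fin n), ∀ b, b = !decide (l + 1 ≤ s.card) →
      ∑' T, A T * T.run p (bitsOf s) b ≤ ENNReal.ofReal δ := by
    rintro s b rfl
    have := FixedLengthAlg.tsum_le_of_worstCaseError_le hA (bitsOf s)
    rwa [thresholdFn_bitsOf] at this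
  have hG : ∑' T, A T * G T ≤ ENNReal.ofReal (2 * (Y.card * P.card * δ)) := by
    have e : ∀ T, A T * G T = Y.card * ∑ s ∈ P, A T * T.run p (bitsOf s) true +
        P.card * ∑ y ∈ Y, A T * T.run p (bitsOf y) false := fun T => by
      simp only [G, ← Finset.mul_sum]; ring
    simp only [e]
    rw [ENNReal.tsum_add, ENNReal.tsum_mul_left, ENNReal.tsum_mul_left,
      Summable.tsum_finsetSum (fun _ _ => ENNReal.summable),
      Summable.tsum_finsetSum (fun _ _ => ENNReal.summable)]
    have h1 : ∑ s ∈ P, ∑' T, A T * T.run p (bitsOf s) true ≤ P.card * ENNReal.ofReal δ := by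
      rw [← nsmul_eq_mul]
      refine Finset.sum_le_card_nsmul _ _ _ fun s hs => herr s _ ?_
      rw [hP, Finset.mem_powersetCard_univ] at hs
      simp [hs]
    have h2 : ∑ y ∈ Y, ∑' T, A T * T.run p (bitsOf y) false ≤ Y.card * ENNReal.ofReal δ := by
      rw [← nsmul_eq_mul]
      refine Finset.sum_le_card_nsmul _ _ _ fun s hs => herr s _ ?_
      rw [hY, Finset.mem_powersetCard_univ] at hs
      simp [hs]
    calc _ ≤ (Y.card : ENNReal) * (P.card * ENNReal.ofReal δ) +
          P.card * (Y.card * ENNReal.ofReal δ) := by gcongr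
      _ = 2 * (Y.card * P.card * ENNReal.ofReal δ) := by ring
      _ = _ := by
        rw [ENNReal.ofReal_mul (by norm_num), ENNReal.ofReal_mul (by positivity),
          ENNReal.ofReal_mul (by positivity), ENNReal.ofReal_natCast, ENNReal.ofReal_natCast]
        norm_num
  have hpos : 0 < (Y.card : ℝ) * P.card * δ := by positivity
  -- Relaxing `2` to `3` gives the strict inequality needed to select a tree.
  obtain ⟨T, hT⟩ := A.exists_lt_of_tsum_mul_lt G
    (d := ENNReal.ofReal (3 * (Y.card * P.card * δ)))
    (hG.trans_lt ((ENNReal.ofReal_lt_ofReal_iff (by positivity)).2 (by linarith)))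
  have hGr : (G T).toReal = Y.card * ∑ s ∈ P, (T.run p (bitsOf s) true).toReal +
      P.card * ∑ y ∈ Y, (T.run p (bitsOf y) false).toReal := by
    have hne : ∀ b, ∀ Z : Finset (Finset (Fin n)), ∑ s ∈ Z, T.run p (bitsOf s) b ≠ ⊤ :=
      fun b Z => (ENNReal.sum_lt_top.2 fun s _ => (PMF.apply_lt_top _ _)).ne
    simp only [G]
    rw [ENNReal.toReal_add (ENNReal.mul_ne_top (ENNReal.natCast_ne_top _) (hne _ _))
      (ENNReal.mul_ne_top (ENNReal.natCast_ne_top _) (hne _ _)), ENNReal.toReal_mul,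
      ENNReal.toReal_mul, ENNReal.toReal_sum fun s _ => PMF.apply_ne_top _ _,
      ENNReal.toReal_sum fun s _ => PMF.apply_ne_top _ _]
    simp
  have hT' : (G T).toReal ≤ 3 * (Y.card * P.card * δ) :=
    ENNReal.toReal_le_of_le_ofReal (by positivity) hT.le
  rw [hGr, sum_run_false_eq p hL, Finset.mul_sum, Finset.mul_sum, ← Finset.sum_add_distrib] at hT'
  have hsum : ∑ s ∈ P, ((Y.card : ℝ) * (T.run p (bitsOf s) true).toReal + P.card *
      T.expect p (bitsOf s) (fun S b => if b = false then missWeight L s S else 0) 0) ≤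
      ∑ s ∈ P, 3 * (Y.card * δ) := by
    refine hT'.trans (le_of_eq ?_)
    rw [Finset.sum_const, nsmul_eq_mul]; ring
  obtain ⟨s, hs, hle⟩ := Finset.exists_le_of_sum_le (Finset.card_pos.1 hPpos) hsum
  refine ⟨T, s, by simpa [hP] using hs, ?_⟩
  have hchoose : (Y.card : ℝ) * (l + 1 : ℕ) = P.card * (n - l : ℕ) := by
    rw [hYc, hPc]; exact_mod_cast Nat.choose_succ_right_eq n l
  have hnl : (0 : ℝ) < (n - l : ℕ) := by exact_mod_cast Nat.sub_pos_of_lt hl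
  have hY' : (0 : ℝ) < Y.card := by exact_mod_cast hYpos
  have hratio : ((l + 1 : ℕ) : ℝ) / (n - l : ℕ) = P.card / Y.card := by
    rw [div_eq_div_iff hnl.ne' hY'.ne', ← hchoose]; ring
  rw [hratio]
  refine le_of_mul_le_mul_left ?_ hY'
  refine le_trans (le_of_eq ?_) (hle.trans (le_of_eq ?_))
  · field_simp
  · ring

/-! ### Necessity: the nonasymptotic bound. -/

/-- Jensen's inequality: if the average of `1 / (exp u_j + Q)` is small, then the average of
`u_j` is large. -/
lemma log_div_le_average {ι : Type*} (J : Finset ι) (hJ : J.Nonempty) (u : ι → ℝ)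
    {Q k δ : ℝ} (hk : 1 ≤ k) (hδ : 0 < δ) (hQ0 : 0 ≤ Q) (hQ : Q ≤ 8 * k)
    (hu : ∑ j ∈ J, Real.exp (-u j) ≤ 8 * J.card)
    (hf : ∑ j ∈ J, (Real.exp (u j) + Q)⁻¹ ≤ J.card * (12 * δ / k)) :
    Real.log (k / δ) - Real.log 24 ≤
      (∑ j ∈ J, u j) / J.card + 8 + 192 * δ * Real.log (8 * k) := by
  have hN : (0 : ℝ) < J.card := by exact_mod_cast hJ.card_pos
  have hk0 : 0 < k := by linarith
  set B := Real.log (8 * k) with hB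
  have hB0 : 0 ≤ B := Real.log_nonneg (by linarith)
  have hexpB : Real.exp B = 8 * k := Real.exp_log (by linarith)
  -- Above the level `B`, `exp` dominates `Q`, so `exp(-v)` is comparable to the given reciprocals.
  -- By `hf`, at most a share `192 δ` of the indices lies below `B`; raising `u j` there costs at
  -- most `B + exp(-u j)`.
  let v : ι → ℝ := fun j => max (u j) B
  have hfpos : ∀ j, 0 < (Real.exp (u j) + Q)⁻¹ := fun j => by positivity
  have h1 : ∀ j, Real.exp (-v j) ≤ 2 * (Real.exp (u j) + Q)⁻¹ := fun j => by
    have h2 : Real.exp (u j) + Q ≤ 2 * Real.exp (v j) := by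
      have := Real.exp_le_exp.2 (le_max_left (u j) B)
      have := Real.exp_le_exp.2 (le_max_right (u j) B)
      simp only [v]; linarith
    rw [Real.exp_neg, ← div_eq_mul_inv, inv_eq_one_div, div_le_div_iff₀ (Real.exp_pos _)
      (by positivity)]
    linarith
  have h2 : ∀ j, v j ≤ u j + Real.exp (-u j) + B * (16 * k) * (Real.exp (u j) + Q)⁻¹ := fun j => by
    simp only [v]
    have hB' : 0 ≤ B * (16 * k) * (Real.exp (u j) + Q)⁻¹ :=
      mul_nonneg (by positivity) (hfpos j).le
    rcases le_total B (u j) with h | h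
    · rw [max_eq_left h]
      have := Real.exp_pos (-u j)
      linarith
    · rw [max_eq_right h]
      have h3 : 1 ≤ 16 * k * (Real.exp (u j) + Q)⁻¹ := by
        rw [← div_eq_mul_inv, le_div_iff₀ (by positivity)]
        have := Real.exp_le_exp.2 h
        linarith
      have h4 := Real.add_one_le_exp (-u j)
      nlinarith
  have h3 : Real.exp ((∑ j ∈ J, -v j) / J.card) ≤ (∑ j ∈ J, Real.exp (-v j)) / J.card := by
    have := convexOn_exp.map_sum_le (t := J) (w := fun _ => (J.card : ℝ)⁻¹) (p := fun j => -v j)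
      (fun _ _ => by positivity) (by simp [hN.ne']) (fun _ _ => Set.mem_univ _)
    simp only [smul_eq_mul, ← Finset.mul_sum] at this
    rwa [div_eq_inv_mul, div_eq_inv_mul]
  have h4 : (∑ j ∈ J, Real.exp (-v j)) / J.card ≤ 24 * δ / k := by
    rw [div_le_iff₀ hN]
    calc _ ≤ ∑ j ∈ J, 2 * (Real.exp (u j) + Q)⁻¹ := Finset.sum_le_sum fun j _ => h1 j
      _ ≤ 2 * (J.card * (12 * δ / k)) := by rw [← Finset.mul_sum]; gcongr
      _ = _ := by ring
  have h5 : -((∑ j ∈ J, v j) / J.card) ≤ -(Real.log (k / δ) - Real.log 24) := by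
    rw [← Real.log_div (by positivity) (by norm_num), ← Real.log_inv,
      Real.le_log_iff_exp_le (by positivity)]
    have := h3.trans h4
    rw [Finset.sum_neg_distrib, neg_div] at this
    refine this.trans (le_of_eq ?_)
    field_simp
  have h6 : (∑ j ∈ J, v j) / J.card ≤
      (∑ j ∈ J, u j) / J.card + 8 + 192 * δ * B := by
    have h7 : ∑ j ∈ J, v j ≤ ∑ j ∈ J, u j + 8 * J.card + B * (16 * k) * (J.card * (12 * δ / k)) := by
      calc _ ≤ ∑ j ∈ J, (u j + Real.exp (-u j) + B * (16 * k) * (Real.exp (u j) + Q)⁻¹) :=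
            Finset.sum_le_sum fun j _ => h2 j
        _ ≤ _ := by
          rw [Finset.sum_add_distrib, Finset.sum_add_distrib, ← Finset.mul_sum]
          gcongr
    rw [div_le_iff₀ hN]
    refine h7.trans (le_of_eq ?_)
    field_simp
    ring
  linarith

/-- Nonasymptotic lower bound on the number of queries. -/
lemma log_div_le_of_worstCaseError_le {n m k : ℕ} (hk : 1 ≤ k) (hkn : k ≤ n) (p : unitInterval)
    {L δ l c : ℝ} (hL0 : 0 ≤ L) (hL : p * Real.exp L = 1 - p) (hδ : 0 < δ) (hδ1 : 12 * δ ≤ 1)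
    (hl : 0 < l) (hc : 0 ≤ c) (hlc : p * Real.exp (-l) + (1 - p) * Real.exp l ≤ Real.exp c)
    (A : FixedLengthAlg n m) (hA : FixedLengthAlg.worstCaseError p k A ≤ δ) :
    Real.log (k / δ) - Real.log 24 ≤
      L * ((c * m + Real.log 8) / l) / (n - k + 1) + 8 + 192 * δ * Real.log (8 * k) := by
  by_contra! hlt
  obtain ⟨d, rfl⟩ : ∃ d, k = d + 1 := ⟨k - 1, by omega⟩
  obtain ⟨T, s, hs, hle⟩ := exists_tree_input (Nat.lt_of_succ_le hkn) p hL hδ A hA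
  have hcc : (sᶜ).card = n - d := by rw [Finset.card_compl, hs, Fintype.card_fin]
  have hN : (0 : ℝ) < (n - d : ℕ) := by exact_mod_cast Nat.sub_pos_of_lt (Nat.lt_of_succ_le hkn)
  have hNe : ((n - d : ℕ) : ℝ) = n - (d + 1 : ℕ) + 1 := by
    rw [Nat.cast_sub (by omega)]; push_cast; ring
  rw [← hNe] at hlt
  set N : ℝ := ((n - d : ℕ) : ℝ) with hNdef
  set K : ℝ := ((d + 1 : ℕ) : ℝ) with hKdef
  have hK : 1 ≤ K := by rw [hKdef]; exact_mod_cast hk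
  let F₁ : (Fin n → ℤ) → Bool → ℝ := fun _ b => if b = true then 1 else 0
  let F₂ : (Fin n → ℤ) → Bool → ℝ := fun S b => if b = false then missWeight L s S else 0
  let F₃ : (Fin n → ℤ) → Bool → ℝ := fun S _ => ∑ i ∈ s, Real.exp (L * S i)
  let F₄ : (Fin n → ℤ) → Bool → ℝ := fun S _ => ∑ j ∈ sᶜ, Real.exp (-(L * S j))
  let F₅ : (Fin n → ℤ) → Bool → ℝ := fun S _ => Real.exp (l * ∑ j ∈ sᶜ, (S j : ℝ))
  -- Several Markov inequalities in one: if every term were below `1`, Jensen would contradict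
  -- `hlt`. Yet the expectations total at most `1/4 + 3 · 1/8 < 1`, the first two sharing the budget
  -- `3δ / (12δ)`.
  have hpt : ∀ S b, 1 ≤ F₁ S b * (12 * δ)⁻¹ + F₂ S b * (K / N * (12 * δ)⁻¹) + F₃ S b * (8 * K)⁻¹ +
      F₄ S b * (8 * N)⁻¹ + F₅ S b * (8 * Real.exp (c * m))⁻¹ := by
    intro S b
    by_contra! hlt1
    have hmw : 0 ≤ missWeight L s S := Finset.sum_nonneg fun j _ => by positivity
    have t1 : 0 ≤ F₁ S b * (12 * δ)⁻¹ := by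
      refine mul_nonneg ?_ (by positivity); simp only [F₁]; split_ifs
      exacts [zero_le_one, le_rfl]
    have t2 : 0 ≤ F₂ S b * (K / N * (12 * δ)⁻¹) := by
      refine mul_nonneg ?_ (by positivity); simp only [F₂]; split_ifs
      exacts [hmw, le_rfl]
    have n3 : 0 ≤ F₃ S b := Finset.sum_nonneg fun _ _ => (Real.exp_pos _).le
    have n4 : 0 ≤ F₄ S b := Finset.sum_nonneg fun _ _ => (Real.exp_pos _).le
    have t3 : 0 ≤ F₃ S b * (8 * K)⁻¹ := mul_nonneg n3 (by positivity)
    have t4 : 0 ≤ F₄ S b * (8 * N)⁻¹ := mul_nonneg n4 (by positivity)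
    have t5 : 0 ≤ F₅ S b * (8 * Real.exp (c * m))⁻¹ := by positivity
    have hb : b = false := by
      by_contra hb
      rw [Bool.not_eq_false] at hb
      have : F₁ S b * (12 * δ)⁻¹ < 1 := by linarith
      rw [← div_eq_mul_inv, div_lt_one (by positivity)] at this
      simp only [F₁, hb, if_true] at this
      linarith
    have s2 : F₂ S b * (K / N * (12 * δ)⁻¹) ≤ 1 := by linarith
    have s3 : F₃ S b * (8 * K)⁻¹ ≤ 1 := by linarith
    have s4 : F₄ S b * (8 * N)⁻¹ ≤ 1 := by linarith
    have s5 : F₅ S b * (8 * Real.exp (c * m))⁻¹ ≤ 1 := by linarith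
    rw [← div_eq_mul_inv, div_le_one (by positivity)] at s3 s4 s5
    have s2' : missWeight L s S ≤ N * (12 * δ / K) := by
      simp only [F₂, hb, if_true] at s2
      have e : missWeight L s S * (K / N * (12 * δ)⁻¹) = missWeight L s S / (N * (12 * δ / K)) := by
        field_simp
      rwa [e, div_le_one (by positivity)] at s2
    have hne : (sᶜ).Nonempty := by
      rw [← Finset.card_pos, hcc]; exact Nat.sub_pos_of_lt (Nat.lt_of_succ_le hkn)
    have hmain := log_div_le_average sᶜ hne (fun j => L * (S j : ℝ)) (Q := F₃ S b) hK hδ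
      n3 s3 (by rw [hcc]; exact s4) (by rw [hcc]; exact s2')
    rw [hcc, ← Finset.mul_sum] at hmain
    have hS : ∑ j ∈ sᶜ, (S j : ℝ) ≤ (c * m + Real.log 8) / l := by
      rw [le_div_iff₀ hl, mul_comm, ← Real.exp_le_exp, Real.exp_add, Real.exp_log (by norm_num)]
      linarith
    have : (L * ∑ j ∈ sᶜ, (S j : ℝ)) / N ≤ L * ((c * m + Real.log 8) / l) / N := by
      gcongr
    linarith
  have hE := QueryTree.expect_mono (x := bitsOf s) p.2.1 p.2.2 hpt T 0
  rw [QueryTree.expect_const, QueryTree.expect_add, QueryTree.expect_add, QueryTree.expect_add,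
    QueryTree.expect_add, QueryTree.expect_mul_const, QueryTree.expect_mul_const,
    QueryTree.expect_mul_const, QueryTree.expect_mul_const, QueryTree.expect_mul_const,
    QueryTree.expect_sum, QueryTree.expect_sum, ← QueryTree.run_apply_toReal] at hE
  have e3 : ∑ i ∈ s, T.expect p (bitsOf s) (fun S _ => Real.exp (L * S i)) 0 = d := by
    rw [Finset.sum_congr rfl fun i hi => QueryTree.expect_exp i (by simp [bitsOf, hi]) hL T]
    simp [hs]
  have e4 : ∑ j ∈ sᶜ, T.expect p (bitsOf s) (fun S _ => Real.exp (-(L * S j))) 0 = N := by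
    rw [Finset.sum_congr rfl fun j hj => QueryTree.expect_exp_neg j
      (by simpa [bitsOf] using hj) hL T]
    simp [hcc, hNdef]
  have e5 : T.expect p (bitsOf s) F₅ 0 ≤ Real.exp (c * m) := by
    have := QueryTree.expect_exp_sum_le (x := bitsOf s) p.2.1 p.2.2 sᶜ
      (fun j hj => by simpa [bitsOf] using hj) hc hlc T 0
    simpa using this
  rw [e3, e4] at hE
  have g3 : (d : ℝ) * (8 * K)⁻¹ ≤ 1 / 8 := by
    rw [← div_eq_mul_inv, div_le_div_iff₀ (by positivity) (by norm_num), hKdef]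
    push_cast; linarith
  have g4 : N * (8 * N)⁻¹ = 1 / 8 := by field_simp
  have g5 : T.expect p (bitsOf s) F₅ 0 * (8 * Real.exp (c * m))⁻¹ ≤ 1 / 8 := by
    rw [← div_eq_mul_inv, div_le_div_iff₀ (by positivity) (by norm_num)]
    linarith
  have g12 : (T.run p (bitsOf s) true).toReal * (12 * δ)⁻¹ +
      T.expect p (bitsOf s) F₂ 0 * (K / N * (12 * δ)⁻¹) ≤ 1 / 4 := by
    have e : (T.run p (bitsOf s) true).toReal * (12 * δ)⁻¹ +
      T.expect p (bitsOf s) F₂ 0 * (K / N * (12 * δ)⁻¹) =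
      ((T.run p (bitsOf s) true).toReal + K / N * T.expect p (bitsOf s) F₂ 0) / (12 * δ) := by
      rw [div_eq_mul_inv _ (12 * δ)]; ring
    rw [e, div_le_div_iff₀ (by positivity) (by norm_num)]
    linarith
  linarith

/-! ### Asymptotics. -/

/-- Diagonal choice: at `n`, use the tolerance `1/(j+1)` for the largest `j ≤ n` whose threshold `N
j` has been passed. -/
lemma exists_seq_tendsto_zero_of_eventually {P : ℝ → ℕ → Prop}
    (h : ∀ η : ℝ, 0 < η → η ≤ 1 → ∀ᶠ n in atTop, P η n) :
    ∃ η : ℕ → ℝ, Tendsto η atTop (𝓝 0) ∧ ∀ᶠ n in atTop, P (η n) n := by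
  classical
  have h' : ∀ j : ℕ, ∃ N, ∀ n ≥ N, P (1 / ((j : ℝ) + 1)) n := fun j =>
    eventually_atTop.1 (h _ (by positivity) (by
      rw [div_le_one (by positivity)]; have : (0 : ℝ) ≤ j := by positivity
      linarith))
  choose N hN using h'
  let J : ℕ → ℕ := fun n => Nat.findGreatest (fun j => N j ≤ n) n
  have hJ : Tendsto J atTop atTop := by
    refine tendsto_atTop.2 fun j => ?_
    filter_upwards [eventually_ge_atTop (N j), eventually_ge_atTop j] with n h1 h2
    exact Nat.le_findGreatest h2 h1
  refine ⟨fun n => 1 / ((J n : ℝ) + 1), tendsto_one_div_add_atTop_nhds_zero_nat.comp hJ, ?_⟩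
  filter_upwards [eventually_ge_atTop (N 0)] with n hn
  exact hN _ _ (Nat.findGreatest_spec (P := fun j => N j ≤ n) (Nat.zero_le n) hn)

/-- First order upper bound on the moment generating function of a noisy `±1` reading. -/
lemma mgf_le {p : ℝ} (h0 : 0 ≤ p) (h1 : p ≤ 1) {z : ℝ} (hz : |z| ≤ 1) :
    p * Real.exp z + (1 - p) * Real.exp (-z) ≤ Real.exp (-(z * (1 - 2 * p)) + z ^ 2) := by
  have e1 := (abs_le.1 (Real.abs_exp_sub_one_sub_id_le hz)).2
  have e2 := (abs_le.1 (Real.abs_exp_sub_one_sub_id_le (x := -z) (by rwa [abs_neg]))).2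
  have e3 := Real.add_one_le_exp (-(z * (1 - 2 * p)) + z ^ 2)
  have e4 := mul_le_mul_of_nonneg_left e1 h0
  have e5 := mul_le_mul_of_nonneg_left e2 (sub_nonneg.2 h1)
  nlinarith

section Asymptotics

variable {p : unitInterval} {k : ℕ → ℕ} {δ : ℕ → ℝ}

lemma eventually_necessity (hp0 : (0 : ℝ) < p) (hp1 : (p : ℝ) < 1 / 2)
    (hk1 : ∀ᶠ n : ℕ in atTop, 1 ≤ k n)
    (hk : (fun n : ℕ => (k n : ℝ)) =o[atTop] (fun n : ℕ => (n : ℝ)))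
    (hδ : Tendsto δ atTop (𝓝 0)) (hδ0 : ∀ᶠ n in atTop, 0 < δ n)
    (hΛ : Tendsto (fun n => Real.log (k n / δ n)) atTop atTop) {ρ : ℝ} (hρ : 0 < ρ)
    (hρ1 : ρ ≤ 1 / 8) :
    ∀ᶠ n : ℕ in atTop, ∀ (m : ℕ) (A : FixedLengthAlg n m),
      FixedLengthAlg.worstCaseError p (k n) A ≤ δ n →
        (1 - 5 * ρ) * queryBenchmark p n (k n) (δ n) ≤ m := by
  set L := Real.log ((1 - p) / p) with hLdef
  have hLpos : 0 < L := Real.log_pos (by rw [one_lt_div hp0]; linarith)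
  have hL : p * Real.exp L = 1 - p := by
    rw [hLdef, Real.exp_log (div_pos (by linarith) hp0)]; field_simp
  have hd : 0 < 1 - 2 * (p : ℝ) := by linarith
  set l := ρ * (1 - 2 * (p : ℝ)) with hl
  have hl0 : 0 < l := by positivity
  have hl1 : l ≤ 1 := by rw [hl]; nlinarith
  -- By the choice of `l`, the quadratic term `l ^ 2` is a `ρ` fraction of the drift term.
  set c := l * (1 - 2 * p) * (1 + ρ) with hc
  have hlc : p * Real.exp (-l) + (1 - p) * Real.exp l ≤ Real.exp c := by
    have := mgf_le hp0.le (by linarith) (z := -l) (by rw [abs_neg, abs_of_pos hl0]; exact hl1)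
    rw [neg_neg] at this
    refine this.trans (le_of_eq ?_)
    congr 1
    rw [hc, hl]; ring
  set C₁ := Real.log 24 + 8 + 16 * Real.log 8
  set C₂ := L * Real.log 8 / l
  filter_upwards [hk1, hδ0, hk.bound hρ, hδ.eventually (gt_mem_nhds (show (0 : ℝ) < ρ / 192 by positivity)),
    hδ.eventually (gt_mem_nhds (show (0 : ℝ) < 1 / 12 by norm_num)),
    hΛ.eventually_ge_atTop (C₁ / ρ), hΛ.eventually_ge_atTop (C₂ / ρ), hΛ.eventually_ge_atTop 0,
    eventually_ge_atTop 1] with n h1 h2 h3 h4 h5 h6 h7 h8 h9 m A hA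
  simp only [Real.norm_natCast] at h3
  have hn : (1 : ℝ) ≤ n := by exact_mod_cast h9
  have hK : (1 : ℝ) ≤ k n := by exact_mod_cast h1
  have hkn : k n ≤ n := by
    have : (k n : ℝ) ≤ n := by nlinarith
    exact_mod_cast this
  have main := log_div_le_of_worstCaseError_le h1 hkn p hLpos.le hL h2 (by linarith) hl0
    (by positivity) hlc A hA
  set Λ := Real.log (k n / δ n) with hΛdef
  have hlog : Real.log (8 * k n) ≤ Real.log 8 + Λ := by
    rw [hΛdef, Real.log_mul (by norm_num) (by positivity), Real.log_div (by positivity) h2.ne']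
    have := Real.log_nonpos h2.le (by linarith)
    linarith
  have hlog8 : 0 ≤ Real.log 8 := Real.log_nonneg (by norm_num)
  rw [div_le_iff₀ hρ] at h6 h7
  have hN : (0 : ℝ) < n - k n + 1 := by
    have : (k n : ℝ) ≤ n := by exact_mod_cast hkn
    linarith
  have e1 : 192 * δ n * Real.log (8 * k n) ≤ 16 * Real.log 8 + ρ * Λ := by
    have a1 : 192 * δ n * Real.log (8 * k n) ≤ 192 * δ n * (Real.log 8 + Λ) := by gcongr
    have a2 : 192 * δ n * Real.log 8 ≤ 16 * Real.log 8 := by gcongr; linarith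
    have a3 : 192 * δ n * Λ ≤ ρ * Λ := by gcongr; linarith
    linarith
  have e2 : L * ((c * m + Real.log 8) / l) = (1 - 2 * p) * L * (1 + ρ) * m + C₂ := by
    simp only [hc, C₂]; field_simp
  rw [e2] at main
  have e3 : (1 - 2 * ρ) * Λ ≤ ((1 - 2 * p) * L * (1 + ρ) * m + C₂) / (n - k n + 1) := by
    have : C₁ = Real.log 24 + 8 + 16 * Real.log 8 := rfl
    linarith
  rw [le_div_iff₀ hN] at e3
  have e4 : (1 - 2 * ρ) * Λ * ((1 - ρ) * n) ≤ (1 - 2 * ρ) * Λ * (n - k n + 1) := by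
    have : 0 ≤ (1 - 2 * ρ) * Λ := mul_nonneg (by linarith) h8
    gcongr
    linarith
  have e5 : C₂ ≤ ρ * (n * Λ) := by
    have : Λ * ρ ≤ n * (Λ * ρ) := le_mul_of_one_le_left (by positivity) hn
    linarith
  have hX : 0 ≤ n * Λ := by positivity
  rw [queryBenchmark, klBern_symm p hp0 (by linarith), ← hLdef, ← hΛdef, ← mul_div_assoc,
    div_le_iff₀ (by positivity)]
  -- The accumulated factor `(1 - 2ρ)(1 - ρ) - ρ` is at least `(1 + ρ)(1 - 5ρ)`.
  have e6 : (1 + ρ) * ((1 - 5 * ρ) * (n * Λ)) ≤ (1 + ρ) * (m * ((1 - 2 * p) * L)) := by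
    have : 0 ≤ ρ ^ 2 * (n * Λ) := by positivity
    linarith
  exact le_of_mul_le_mul_left e6 (by linarith)

lemma eventually_sufficiency (hp0 : (0 : ℝ) < p) (hp1 : (p : ℝ) < 1 / 2)
    (hk1 : ∀ᶠ n : ℕ in atTop, 1 ≤ k n)
    (hk : (fun n : ℕ => (k n : ℝ)) =o[atTop] (fun n : ℕ => (n : ℝ)))
    (hδ0 : ∀ᶠ n in atTop, 0 < δ n)
    (hΛ : Tendsto (fun n => Real.log (k n / δ n)) atTop atTop) {ρ : ℝ} (hρ : 0 < ρ)
    (hρ1 : ρ ≤ 1 / 8) :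
    ∀ᶠ n : ℕ in atTop, ∃ (m : ℕ) (T : QueryTree n m),
      (m : ℝ) ≤ (1 + 8 * ρ) * queryBenchmark p n (k n) (δ n) ∧
      FixedLengthAlg.worstCaseError p (k n) (PMF.pure T : FixedLengthAlg n m) ≤ δ n := by
  set L := Real.log ((1 - p) / p) with hLdef
  have hLpos : 0 < L := Real.log_pos (by rw [one_lt_div hp0]; linarith)
  have hL : p * Real.exp L + (1 - p) * Real.exp (-L) = 1 := by
    rw [Real.exp_neg, hLdef, Real.exp_log (div_pos (by linarith) hp0)]
    have : (1 : ℝ) - p ≠ 0 := by linarith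
    field_simp
    ring
  have hd : 0 < 1 - 2 * (p : ℝ) := by linarith
  set θ := ρ * (1 - 2 * (p : ℝ)) with hθ
  have hθ0 : 0 < θ := by positivity
  have hθ1 : θ ≤ 1 := by rw [hθ]; nlinarith
  set t := θ * (1 - 2 * p) * (1 - ρ) with ht
  have hθt : p * Real.exp θ + (1 - p) * Real.exp (-θ) ≤ Real.exp (-t) := by
    have := mgf_le hp0.le (by linarith) (z := θ) (by rw [abs_of_pos hθ0]; exact hθ1)
    refine this.trans (le_of_eq ?_)
    congr 1
    rw [ht, hθ]; ring
  filter_upwards [hk1, hδ0, hk.bound (half_pos hρ), hΛ.eventually_ge_atTop (L / ρ),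
    hΛ.eventually_ge_atTop (4 / ρ), hΛ.eventually_ge_atTop 1,
    tendsto_natCast_atTop_atTop.eventually_ge_atTop (L / (ρ * θ)),
    eventually_ge_atTop 1] with n h1 h2 h3 h4 h5 h6 h7 h8
  simp only [Real.norm_natCast] at h3
  have hn : (1 : ℝ) ≤ n := by exact_mod_cast h8
  have hK : (1 : ℝ) ≤ k n := by exact_mod_cast h1
  set Λ := Real.log (k n / δ n) with hΛdef
  have hΛ0 : 0 < Λ := by linarith
  set X := n * Λ / L with hX
  have hX0 : 0 < X := by positivity
  rw [div_le_iff₀ hρ] at h4 h5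
  rw [div_le_iff₀ (by positivity)] at h7
  have hlogb : Real.log (2 * n / δ n) = Real.log (2 * n / k n) + Λ := by
    rw [hΛdef, ← Real.log_mul (by positivity) (by positivity)]
    congr 1; field_simp
  have hkn : (k n : ℝ) ≤ n := by nlinarith
  have hlogb0 : 0 < Real.log (2 * n / δ n) := by
    rw [hlogb]
    have : 0 ≤ Real.log (2 * n / k n) := Real.log_nonneg (by
      rw [le_div_iff₀ (by linarith)]; linarith)
    linarith
  set a : ℤ := ⌈Λ / L⌉ with ha
  set b : ℤ := ⌈Real.log (2 * n / δ n) / L⌉ with hb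
  have ha1 : 1 ≤ a := Int.one_le_ceil_iff.2 (by positivity)
  have hb1 : 1 ≤ b := Int.one_le_ceil_iff.2 (by positivity)
  have haL : Λ ≤ L * a := by
    have := Int.le_ceil (Λ / L)
    rw [div_le_iff₀ hLpos] at this
    rw [mul_comm L]; exact this
  have hbL : Real.log (2 * n / δ n) ≤ L * b := by
    have := Int.le_ceil (Real.log (2 * n / δ n) / L)
    rw [div_le_iff₀ hLpos] at this
    rw [mul_comm L]; exact this
  have hau : (a : ℝ) ≤ Λ / L + 1 := (Int.ceil_lt_add_one _).le
  have hbu : (b : ℝ) ≤ Real.log (2 * n / δ n) / L + 1 := (Int.ceil_lt_add_one _).le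
  have hQ : queryBenchmark p n (k n) (δ n) = X / (1 - 2 * p) := by
    rw [queryBenchmark, klBern_symm p hp0 (by linarith), ← hLdef, ← hΛdef, hX, div_div, mul_comm L]
  -- The distance is at most `(1 + 3ρ) X`. The slack `8ρ` pays for this, for the factor `1 - ρ` in
  -- `t` and for the floor, and leaves `2ρX`.
  set q := (1 + 8 * ρ) * (X / (1 - 2 * p)) with hq
  have hq0 : 0 ≤ q := by positivity
  refine ⟨⌊q⌋₊, scanTree h8 (k n) a b ⌊q⌋₊, by rw [hQ]; exact Nat.floor_le hq0, ?_⟩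
  have hm : q - 1 ≤ (⌊q⌋₊ : ℝ) := (Nat.sub_one_lt_floor q).le
  refine scanTree_worstCaseError_le h8 (k n) p ha1 hb1 hLpos.le hθ0.le hL hθt _ ?_ ?_
  · calc (k n : ℝ) * Real.exp (-(L * a)) ≤ k n * Real.exp (-Λ) := by gcongr
      _ = δ n := by
        rw [Real.exp_neg, hΛdef, Real.exp_log (by positivity)]; field_simp
  · have f1 : n * Real.exp (-(L * b)) ≤ δ n / 2 := by
      calc (n : ℝ) * Real.exp (-(L * b)) ≤ n * Real.exp (-Real.log (2 * n / δ n)) := by gcongr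
        _ = δ n / 2 := by
          rw [Real.exp_neg, Real.exp_log (by positivity)]; field_simp
    have g1 : (n : ℝ) ≤ ρ * X := by
      rw [hX, mul_div_assoc', le_div_iff₀ hLpos]
      have := mul_le_mul_of_nonneg_left h4 (by linarith : (0 : ℝ) ≤ n)
      linarith
    have g2 : (a : ℝ) * n ≤ X + ρ * X := by
      have := mul_le_mul_of_nonneg_right hau (by linarith : (0 : ℝ) ≤ n)
      have e : (Λ / L + 1) * n = X + n := by rw [hX]; ring
      linarith
    -- The expensive barrier is affordable: `log(2n/δ) = log(2n/k) + Λ`, and `k log(2n/k) ≤ 2n` is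
    -- small against `n Λ`.
    have g3 : k n * Real.log (2 * n / δ n) / L ≤ ρ * X := by
      rw [hX, mul_div_assoc', div_le_div_iff_of_pos_right hLpos, hlogb]
      have s1 : k n * Real.log (2 * n / k n) ≤ 2 * n := by
        have := Real.log_le_self (x := 2 * n / k n) (by positivity)
        calc k n * Real.log (2 * n / k n) ≤ k n * (2 * n / k n) := by gcongr
          _ = 2 * n := by field_simp
      have s2 : k n * Λ ≤ ρ / 2 * n * Λ := by gcongr
      have s3 : n * 4 ≤ n * (Λ * ρ) := by gcongr
      linarith
    have g4 : (b : ℝ) * k n ≤ ρ * X + ρ * X := by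
      have := mul_le_mul_of_nonneg_right hbu (by linarith : (0 : ℝ) ≤ k n)
      have e : (Real.log (2 * n / δ n) / L + 1) * k n =
        k n * Real.log (2 * n / δ n) / L + k n := by ring
      linarith
    have g5 : θ * ((1 - ρ) * ((1 + 8 * ρ) * X - ρ * X)) ≤ t * ⌊q⌋₊ := by
      have u1 : t * (q - 1) ≤ t * ⌊q⌋₊ := by
        refine mul_le_mul_of_nonneg_left hm ?_
        rw [ht]; exact mul_nonneg (by positivity) (by linarith)
      refine le_trans ?_ u1
      have u2 : t * (q - 1) = θ * ((1 - ρ) * ((1 + 8 * ρ) * X - (1 - 2 * p))) := by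
        rw [ht, hq]; field_simp
      rw [u2]
      have : 0 ≤ 1 - ρ := by linarith
      gcongr
      linarith
    have g6 : θ * (a * n + b * k n) - t * ⌊q⌋₊ ≤ -(2 * ρ * θ * X) := by
      have u1 : θ * (a * n + b * k n) ≤ θ * (X + 3 * ρ * X) :=
        mul_le_mul_of_nonneg_left (by linarith) hθ0.le
      have u2 : θ * (X + 5 * ρ * X) ≤ θ * ((1 - ρ) * ((1 + 8 * ρ) * X - ρ * X)) := by
        gcongr
        have : 0 ≤ (1 / 8 - ρ) * (ρ * X) := mul_nonneg (by linarith) (by positivity)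
        linarith
      linarith
    have g7 : 2 * Λ ≤ 2 * ρ * θ * X := by
      rw [hX, mul_div_assoc', le_div_iff₀ hLpos]
      have := mul_le_mul_of_nonneg_right h7 hΛ0.le
      linarith
    -- One `Λ` absorbs `log δ`, the other, being at least `1`, absorbs `log 2`.
    have g8 : -(2 * Λ) ≤ Real.log (δ n / 2) := by
      rw [Real.log_div h2.ne' (by norm_num)]
      have u1 : Λ = Real.log (k n) - Real.log (δ n) := Real.log_div (by positivity) h2.ne'
      have u2 : 0 ≤ Real.log (k n) := Real.log_nonneg hK
      have u3 := Real.log_two_lt_d9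
      linarith
    have f2 : Real.exp (θ * (a * n + b * k n) - t * ⌊q⌋₊) ≤ δ n / 2 := by
      rw [← Real.le_log_iff_exp_le (by positivity)]
      linarith
    linarith

end Asymptotics

theorem corollary2 (p : unitInterval) (hp0 : (0 : ℝ) < p) (hp1 : (p : ℝ) < 1 / 2)
    (k : ℕ → ℕ) (δ : ℕ → ℝ) (ε : ℝ) (hε : 0 < ε)
    (hk1 : ∀ᶠ n : ℕ in atTop, 1 ≤ k n)
    (hk : (fun n : ℕ => (k n : ℝ)) =o[atTop] (fun n : ℕ => (n : ℝ)))
    (hδ : Tendsto δ atTop (𝓝 0))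
    (hδn : ∀ᶠ n : ℕ in atTop, (n : ℝ) ^ (-1 + ε) ≤ δ n) :
    ∃ η : ℕ → ℝ, Tendsto η atTop (𝓝 0) ∧
      ∀ᶠ n : ℕ in atTop,
        -- necessity, for all fixed-length algorithms
        (∀ (m : ℕ) (A : FixedLengthAlg n m), FixedLengthAlg.worstCaseError p (k n) A ≤ δ n →
          (1 - η n) * queryBenchmark p n (k n) (δ n) ≤ m) ∧
        -- sufficiency, already with a deterministic algorithm
        (∃ (m : ℕ) (T : QueryTree n m),
          (m : ℝ) ≤ (1 + η n) * queryBenchmark p n (k n) (δ n) ∧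
          FixedLengthAlg.worstCaseError p (k n) (PMF.pure T : FixedLengthAlg n m) ≤ δ n) := by
  have hδ0 : ∀ᶠ n in atTop, 0 < δ n := by
    filter_upwards [hδn, eventually_ge_atTop 1] with n h1 h2
    have : (0 : ℝ) < n := by exact_mod_cast h2
    exact (Real.rpow_pos_of_pos this _).trans_le h1
  have hΛ : Tendsto (fun n => Real.log (k n / δ n)) atTop atTop := by
    have h1 : Tendsto δ atTop (𝓝[>] 0) := tendsto_nhdsWithin_iff.2 ⟨hδ, hδ0⟩
    refine tendsto_atTop_mono' _ ?_ (Real.tendsto_log_atTop.comp h1.inv_tendsto_nhdsGT_zero)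
    filter_upwards [hδ0, hk1] with n h2 h3
    have h4 : (1 : ℝ) ≤ k n := by exact_mod_cast h3
    simp only [Function.comp_apply, Pi.inv_apply]
    refine Real.log_le_log (by positivity) ?_
    rw [inv_eq_one_div]
    gcongr
  refine exists_seq_tendsto_zero_of_eventually (P := fun η n =>
    (∀ (m : ℕ) (A : FixedLengthAlg n m), FixedLengthAlg.worstCaseError p (k n) A ≤ δ n →
      (1 - η) * queryBenchmark p n (k n) (δ n) ≤ m) ∧
    (∃ (m : ℕ) (T : QueryTree n m),
      (m : ℝ) ≤ (1 + η) * queryBenchmark p n (k n) (δ n) ∧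
      FixedLengthAlg.worstCaseError p (k n) (PMF.pure T : FixedLengthAlg n m) ≤ δ n))
    fun η hη hη1 => ?_
  filter_upwards [eventually_necessity hp0 hp1 hk1 hk hδ hδ0 hΛ (ρ := η / 8) (by positivity)
      (by linarith), eventually_sufficiency hp0 hp1 hk1 hk hδ0 hΛ (ρ := η / 8) (by positivity)
      (by linarith), hΛ.eventually_ge_atTop 0] with n h1 h2 h3
  refine ⟨fun m A hA => le_trans ?_ (h1 m A hA), ?_⟩
  · have : 0 ≤ queryBenchmark p n (k n) (δ n) :=
      div_nonneg (mul_nonneg n.cast_nonneg h3) ENNReal.toReal_nonneg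
    gcongr
    linarith
  · obtain ⟨m, T, hm, hT⟩ := h2
    exact ⟨m, T, by convert hm using 3; ring, hT⟩
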